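/- **Machine model.** $M(v)$, $v$ a power of two, consists of $v$ processing elements (PEs) $P_0,\dots,P_{v-1}$ with private memories. An algorithm is a sequence of *supersteps* with labels $i$, $0\le i<\log_2 v$; in an $i$-superstep every PE performs local computation and then sends constant-size messages (one matrix element each) to PEs whose index agrees with its own in the $i$ most significant bits; messages are available after the superstep. *Folding* onto $M(p)$, $p\le v$ a power of two, lets $P_j$ of $M(p)$ carry out the work of the $v/p$ consecutive PEs starting with $P_{j(v/p)}$; supersteps with label $\ge\log_2 p$ and messages between PEs with the same host become local computation. The algorithms are *static semiring algorithms*: supersteps, labels, sources and destinations of messages depend only on the input size, and matrix elements are only handled by semiring operations (correctly over every semiring). On $M(p)$, the degree $h^s(n,p)$ of a superstep $s$ is the maximum number of messages sent or received by a PE, $F^i(n,p)$ is the sum of $h^s(n,p)$ over all $i$-supersteps $s$, $S^i(n)$ is the number of $i$-supersteps, and for $\sigma\ge 0$ the communication complexity on $M(p,\sigma)$ is $$H(n,p,\sigma)=\sum_{i=0}^{\log_2 p-1}\bigl(F^i(n,p)+S^i(n)\,\sigma\bigr).$$ An algorithm specified on $M(v(n))$ is $(\alpha,p)$-*wise*,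 for $0<\alpha\le1$ and $1<p\le v(n)$, if its foldings satisfy $\sum_{i<j}F^i(n,2^j)\ge\alpha\frac{p}{2^j}\sum_{i<j}F^i(n,p)$ for all $1\le j\le\log_2 p$ and all $n$. We write $\log x=\max\{1,\log_2 x\}$. **Problem and class.** The $n$-MM problem is to multiply two $\sqrt n\times\sqrt n$ matrices $A,B$; $n$ is an even power of two, $n\ge 4$. $\mathscr C$ is the class of static semiring algorithms for the $n$-MM problem such that, if there are $q$ PEs, (i) no entry of $A$ or $B$ is initially replicated (the initial distribution is otherwise arbitrary), (ii) no PE computes more than $n^{3/2}/\min\{q,11^3\}$ of the multiplicative terms $A[i,k]\cdot B[k,j]$, (iii) all foldings onto $q'$ PEs, $2\le q'<q$, also belong to $\mathscr C$. An algorithm in $\mathscr C$ for $p$ PEs is $\beta$-*optimal* on $M(p,\sigma)$ with respect to $\mathscr C$, $0<\beta\le 1$, if its communication complexity satisfies $H(n,p,\sigma)\le\frac1\beta H'(n,p,\sigma)$ for every $n$ and the communication complexity $H'$ of every algorithm in $\mathscr C$ for $p$ PEs. **Algorithm.** It is specified on $M(n)$; each of $A$, $B$ and the output $C$ is distributed in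 an arbitrary way with one entry per PE. It multiplies recursively: (1) split the PEs into eight segments $S_{hk\ell}$, $h,k,\ell\in\{0,1\}$, of consecutive PEs of equal number, and spread copies of the quadrants $A_{h\ell}$ and $B_{\ell k}$ evenly over $S_{hk\ell}$; (2) recursively compute $M_{hk\ell}=A_{h\ell}B_{\ell k}$ within $S_{hk\ell}$; (3) the PE responsible for an entry of the quadrant $C_{hk}$ collects the corresponding entries of $M_{hk0}$ and $M_{hk1}$ and adds them. The recursion has $\lceil(\log_2 n)/3\rceil$ levels $i=0,1,\dots$, after which each PE solves its subproblems sequentially; if $3\nmid\log_2 n$, the segments at the last level have two or four PEs, and each PE is assigned four or two consecutive ones of the eight subproblems. At level $i$, steps (1) and (3) are $3i$-supersteps, and a further $0$-superstep, for the last additions, ends the algorithm. In each $3i$-superstep, moreover, $P_j$ sends $2^i$ dummy messages to $P_{j+n/2^{3i+1}}$, for $0\le j<n/2^{3i+1}$. **Theorem.** The algorithm belongs to $\mathscr C$, and its communication complexity on $M(p,\sigma)$ (that is, that of its folding onto $p$ PEs) is $$H_{\mathrm{MM}}(n,p,\sigma)=O\!\left(\frac{n}{p^{2/3}}+\sigma\log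 p\right)$$ for every power of two $1<p\le n$ and every $\sigma\ge0$. The algorithm is $(\Theta(1),n)$-wise. It is $\Theta(1)$-optimal with respect to $\mathscr C$ on every $M(p,\sigma)$ with $p$ a power of two, $1<p\le n$, and $\sigma=O\bigl(n/(p^{2/3}\log p)\bigr)$: for every $K>0$ there is $\beta\in(0,1]$, depending only on $K$, such that the folding of the algorithm onto $p$ PEs is in $\mathscr C$ and is $\beta$-optimal on $M(p,\sigma)$ whenever $0\le\sigma\le K\,n/(p^{2/3}\log p)$. All constants are independent of $n$, $p$, $\sigma$ and of the initial and final distributions. -/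

import Mathlib

/-! ### The machine `M(v)` and static semiring algorithms

Throughout a machine has `v = 2 ^ k` processing elements (PEs), indexed by `Fin (2 ^ k)`. -/

/-- The entries of the two `N × N` input matrices `A` and `B`. -/
inductive Entry (N : ℕ) where
  | A (i j : Fin N) : Entry N
  | B (i j : Fin N) : Entry N

/-- The value of an entry on the instance `(A, B)`. -/
def Entry.val {N : ℕ} {S : Type} (A B : Matrix (Fin N) (Fin N) S) : Entry N → S
  | .A i j => A i j
  | .B i j => B i j

/-- The local operations of a PE: semiring operations on its registers.
The first argument is the register that receives the result. -/
inductive Instr (Reg : Type) where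
  | zero (d : Reg) : Instr Reg
  | one (d : Reg) : Instr Reg
  | add (d x y : Reg) : Instr Reg
  | mul (d x y : Reg) : Instr Reg

/-- Renaming of registers. -/
def Instr.rename {Reg Reg' : Type} (f : Reg → Reg') : Instr Reg → Instr Reg'
  | .zero d => .zero (f d)
  | .one d => .one (f d)
  | .add d x y => .add (f d) (f x) (f y)
  | .mul d x y => .mul (f d) (f x) (f y)

open Classical in
/-- Effect of one operation on the local memory of a PE. -/
noncomputable def Instr.exec {Reg S : Type} [Semiring S] (mem : Reg → S) :
    Instr Reg → Reg → S
  | .zero d => Function.update mem d 0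
  | .one d => Function.update mem d 1
  | .add d x y => Function.update mem d (mem x + mem y)
  | .mul d x y => Function.update mem d (mem x * mem y)

/-- Effect of a sequence of operations on the local memory of a PE. -/
noncomputable def runCode {Reg S : Type} [Semiring S] (code : List (Instr Reg))
    (mem : Reg → S) : Reg → S :=
  code.foldl Instr.exec mem

/-- A message: PE `src` sends the content of its register `srcReg` (one semiring element) to
PE `dst`, where it becomes available in register `dstReg` after the barrier. -/
structure Message (k : ℕ) (Reg : Type) where
  src : Fin (2 ^ k)
  dst : Fin (2 ^ k)
  srcReg : Reg
  dstReg : Reg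

/-- One step of an algorithm for `M(2 ^ k)`: every PE executes its local code, then the messages
are exchanged.  A step with `label < k` is a superstep, closed by a barrier of that label.
A step with `label ≥ k` is local computation: by `cluster`, all its "messages" stay within a PE
(they are local copies), and it is no superstep of `M(2 ^ k)`. -/
structure Step (k : ℕ) (Reg : Type) where
  label : ℕ
  code : Fin (2 ^ k) → List (Instr Reg)
  msgs : Finset (Message k Reg)
  /-- Different messages to a PE are stored in different registers. -/
  tagged : ∀ μ ∈ msgs, ∀ ν ∈ msgs, μ.dst = ν.dst → μ.dstReg = ν.dstReg → μ = ν
  /-- Sender and receiver of a message agree in the `label` most significant bits of their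
  `k`-bit indices. -/
  cluster : ∀ μ ∈ msgs, μ.src.val / 2 ^ (k - label) = μ.dst.val / 2 ^ (k - label)

open Classical in
/-- Effect of a step on the global memory: local code, then delivery of the messages. -/
noncomputable def Step.exec {k : ℕ} {Reg S : Type} [Semiring S]
    (mem : Fin (2 ^ k) → Reg → S) (st : Step k Reg) : Fin (2 ^ k) → Reg → S :=
  let loc : Fin (2 ^ k) → Reg → S := fun r => runCode (st.code r) (mem r)
  fun r d =>
    if h : ∃ μ ∈ st.msgs, μ.dst = r ∧ μ.dstReg = d then
      loc h.choose.src h.choose.srcReg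
    else loc r d

/-- The degree of a step: the maximum number of messages sent or received by any PE.
A message from a PE to itself is local and does not count. -/
def Step.degree {k : ℕ} {Reg : Type} (st : Step k Reg) : ℕ :=
  Finset.univ.sup fun r : Fin (2 ^ k) =>
    max (st.msgs.filter fun μ => μ.src = r ∧ μ.dst ≠ r).card
      (st.msgs.filter fun μ => μ.dst = r ∧ μ.src ≠ r).card

/-- A semiring algorithm on `M(2 ^ k)` for instances consisting of two `N × N` matrices.
The steps, their labels and the messages (sources, destinations) do not depend on the values of
the inputs: every such algorithm is static. -/
structure Algorithm (k N : ℕ) where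
  /-- Names of the registers of a PE. -/
  Reg : Type
  steps : List (Step k Reg)
  /-- The input entry, if any, that a register initially contains. -/
  input : Fin (2 ^ k) → Reg → Option (Entry N)
  /-- The PE and the register where an entry of the output matrix is produced. -/
  output : Fin N → Fin N → Fin (2 ^ k) × Reg

namespace Algorithm

variable {k N : ℕ}

/-- Initial memory if the inputs have the values `inst`; registers without input hold `0`. -/
def start (𝒜 : Algorithm k N) {S : Type} [Semiring S] (inst : Entry N → S) :
    Fin (2 ^ k) → 𝒜.Reg → S :=
  fun r d => (𝒜.input r d).elim 0 inst

/-- Final memory. -/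
noncomputable def final (𝒜 : Algorithm k N) {S : Type} [Semiring S] (inst : Entry N → S) :
    Fin (2 ^ k) → 𝒜.Reg → S :=
  𝒜.steps.foldl Step.exec (𝒜.start inst)

/-- The algorithm solves the matrix multiplication problem, over every semiring. -/
def Solves (𝒜 : Algorithm k N) : Prop :=
  ∀ (S : Type) [Semiring S] (A B : Matrix (Fin N) (Fin N) S) (i j : Fin N),
    𝒜.final (Entry.val A B) (𝒜.output i j).1 (𝒜.output i j).2 = (A * B) i j

/-- No entry of the input matrices is initially replicated. -/
def NoReplication (𝒜 : Algorithm k N) : Prop :=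
  ∀ (e : Entry N) (r r' : Fin (2 ^ k)) (d d' : 𝒜.Reg),
    𝒜.input r d = some e → 𝒜.input r' d' = some e → r = r' ∧ d = d'

/-- PE `r` computes the multiplicative term `A[i,l] * B[l,j]`, where `t = (i, l, j)`: it executes
a multiplication whose operands have the values `A[i,l]` and `B[l,j]`, as elements of the free
semiring on the input entries. -/
def Computes (𝒜 : Algorithm k N) (r : Fin (2 ^ k)) (t : Fin N × Fin N × Fin N) : Prop :=
  ∃ (before after : List (Step k 𝒜.Reg)) (st : Step k 𝒜.Reg)
    (code₁ code₂ : List (Instr 𝒜.Reg)) (d x y : 𝒜.Reg),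
    𝒜.steps = before ++ st :: after ∧
    st.code r = code₁ ++ Instr.mul d x y :: code₂ ∧
    runCode code₁ (before.foldl Step.exec (𝒜.start (FreeAlgebra.ι ℕ)) r) x =
      FreeAlgebra.ι ℕ (Entry.A t.1 t.2.1) ∧
    runCode code₁ (before.foldl Step.exec (𝒜.start (FreeAlgebra.ι ℕ)) r) y =
      FreeAlgebra.ι ℕ (Entry.B t.2.1 t.2.2)

/-- No PE computes more than `n ^ (3/2) / min {q, 11 ^ 3}` multiplicative terms, where `n = N ^ 2`
is the size of the matrices and `q = 2 ^ k` the number of PEs. -/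
def BalancedTerms (𝒜 : Algorithm k N) : Prop :=
  ∀ r : Fin (2 ^ k),
    ({t | 𝒜.Computes r t}.ncard : ℝ) ≤ (N : ℝ) ^ 3 / min ((2 : ℝ) ^ k) (11 ^ 3)

/-- The PE of `M(2 ^ j)` that carries out the operations of PE `r` of `M(2 ^ k)`. -/
def block {k j : ℕ} (hj : j ≤ k) (r : Fin (2 ^ k)) : Fin (2 ^ j) :=
  ⟨r.val / 2 ^ (k - j), by
    rw [Nat.div_lt_iff_lt_mul (by positivity), ← pow_add, Nat.add_sub_cancel' hj]
    exact r.isLt⟩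

open Classical in
/-- Folding of a step: PE `R` executes the code of the PEs in its block, on registers of its own
for each of them. -/
noncomputable def foldStep {k j : ℕ} (hj : j ≤ k) {Reg : Type} (st : Step k Reg) :
    Step j (Fin (2 ^ k) × Reg) where
  label := st.label
  code R := (List.finRange (2 ^ k)).flatMap fun r =>
    if block hj r = R then (st.code r).map (Instr.rename (Prod.mk r)) else []
  msgs := st.msgs.image fun μ =>
    ⟨block hj μ.src, block hj μ.dst, (μ.src, μ.srcReg), (μ.dst, μ.dstReg)⟩
  tagged := by
    intro μ hμ ν hν _ h
    obtain ⟨μ', hμ', rfl⟩ := Finset.mem_image.1 hμ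
    obtain ⟨ν', hν', rfl⟩ := Finset.mem_image.1 hν
    rw [st.tagged μ' hμ' ν' hν' (Prod.ext_iff.1 h).1 (Prod.ext_iff.1 h).2]
  cluster := by
    intro μ hμ
    obtain ⟨μ', hμ', rfl⟩ := Finset.mem_image.1 hμ
    have h := st.cluster μ' hμ'
    have e : k - j + (j - st.label) = (k - st.label) + (k - j + (j - st.label) - (k - st.label)) := by
      omega
    simp only [block, Nat.div_div_eq_div_mul, ← pow_add]
    rw [e, pow_add, ← Nat.div_div_eq_div_mul, ← Nat.div_div_eq_div_mul, h]

/-- Folding of an algorithm for `M(2 ^ k)` onto the smaller machine `M(2 ^ j)`. -/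
noncomputable def fold {j : ℕ} (𝒜 : Algorithm k N) (hj : j ≤ k) : Algorithm j N where
  Reg := Fin (2 ^ k) × 𝒜.Reg
  steps := 𝒜.steps.map (foldStep hj)
  input R d := if block hj d.1 = R then 𝒜.input d.1 d.2 else none
  output a b := (block hj (𝒜.output a b).1, 𝒜.output a b)

/-- The number `S^i` of `i`-supersteps. -/
def numSupersteps (𝒜 : Algorithm k N) (i : ℕ) : ℕ :=
  (𝒜.steps.filter fun st => st.label = i).length

/-- The cumulative degree `F^i` of the `i`-supersteps. -/
def cumDegree (𝒜 : Algorithm k N) (i : ℕ) : ℕ :=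
  ((𝒜.steps.filter fun st => st.label = i).map Step.degree).sum

/-- The communication complexity `H` on the evaluation model `M(2 ^ k, σ)`. -/
noncomputable def commComplexity (𝒜 : Algorithm k N) (σ : ℝ) : ℝ :=
  ∑ i ∈ Finset.range k, ((𝒜.cumDegree i : ℝ) + (𝒜.numSupersteps i : ℝ) * σ)

/-- `(α, p)`-wiseness, for `p = 2 ^ l`, of an algorithm specified on `M(2 ^ k)`, `1 < p ≤ 2 ^ k`. -/
def IsWise (𝒜 : Algorithm k N) (α : ℝ) {l : ℕ} (hl : l ≤ k) : Prop :=
  0 < α ∧ α ≤ 1 ∧ 1 ≤ l ∧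
    ∀ (j : ℕ) (_ : 1 ≤ j) (hj : j ≤ l),
      α * ((2 : ℝ) ^ l / 2 ^ j) * ∑ i ∈ Finset.range j, ((𝒜.fold hl).cumDegree i : ℝ) ≤
        ∑ i ∈ Finset.range j, ((𝒜.fold (hj.trans hl)).cumDegree i : ℝ)

/-- The class `𝒞` of static semiring algorithms for matrix multiplication on `2 ^ k` PEs that do
not initially replicate the inputs, have balanced multiplicative terms, and whose foldings all
share these properties. -/
def InClass (𝒜 : Algorithm k N) : Prop :=
  (𝒜.Solves ∧ 𝒜.NoReplication ∧ 𝒜.BalancedTerms) ∧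
    ∀ (j : ℕ) (_ : 1 ≤ j) (hj : j < k),
      (𝒜.fold hj.le).Solves ∧ (𝒜.fold hj.le).NoReplication ∧ (𝒜.fold hj.le).BalancedTerms

/-- `β`-optimality on `M(2 ^ k, σ)` with respect to the class `𝒞`. -/
def IsOptimal (𝒜 : Algorithm k N) (β σ : ℝ) : Prop :=
  𝒜.InClass ∧ ∀ ℬ : Algorithm k N, ℬ.InClass →
    𝒜.commComplexity σ ≤ 1 / β * ℬ.commComplexity σ

end Algorithm

/-- The convention `log x = max {1, log₂ x}`. -/
noncomputable def lg (x : ℝ) : ℝ := max 1 (Real.logb 2 x)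

/-! ### The recursive 8-way algorithm

It is specified on `M(n)`, where `n = 2 ^ (2 * m)`, for matrices of side `2 ^ m`.  We describe it
with the recursion unfolded.  At level `i` there are `8 ^ i` subproblems of side `2 ^ (m - i)`; the
one with coordinates `x y z < 2 ^ i` is the product of the block `(x, z)` of `A` and the block
`(z, y)` of `B`, and contributes to the block `(x, y)` of `C`.  Its eight subproblems
are those with coordinates `2 * x + h`, `2 * y + k`, `2 * z + l`, for `h k l < 2`. -/

namespace MM

/-- The number of levels of the recursion: `log n / 3`, rounded up. -/
def levels (m : ℕ) : ℕ := (2 * m + 2) / 3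

/-- The position, among the `8 ^ i` subproblems of level `i`, of the one with coordinates `x y z`:
the eight subproblems of a problem are consecutive, in the order of `(h, k, l)`. -/
def seg : ℕ → ℕ → ℕ → ℕ → ℕ
  | 0, _, _, _ => 0
  | i + 1, x, y, z => 8 * seg i (x / 2) (y / 2) (z / 2) + (4 * (x % 2) + 2 * (y % 2) + z % 2)

/-- The VP that holds, at level `i ≥ 1`, the entry `(a, b)` (in global coordinates) of one of the
three matrices of the subproblem number `g`.  The `4 ^ (m - i)` entries of the matrix are
listed in row-major order, and the concatenation of the lists of all subproblems is cut into pieces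
of length `2 ^ i`, one for each VP.  Thus, if `3 * i ≤ 2 * m`, they are evenly spread over the segment
of the `n / 8 ^ i` consecutive VPs that are assigned to the subproblem.  If `3 * i > 2 * m`, which
happens at most at the last level, where the segments to be split have two or four VPs, every VP is
assigned four or two consecutive subproblems. -/
def spread (m i g : ℕ) (a b : Fin (2 ^ m)) : Fin (2 ^ (2 * m)) :=
  Fin.ofNat _ ((g * 4 ^ (m - i) +
    (a.val % 2 ^ (m - i) * 2 ^ (m - i) + b.val % 2 ^ (m - i))) / 2 ^ i)

/-- An even distribution of a matrix among the `n` VPs: one entry each. -/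
abbrev Layout (m : ℕ) : Type := Fin (2 ^ m) × Fin (2 ^ m) ≃ Fin (2 ^ (2 * m))

/-- The index of the block of level `i` that contains the row or column `a`. -/
def blk {m : ℕ} (i : ℕ) (a : Fin (2 ^ m)) : ℕ := a.val / 2 ^ (m - i)

/-- The VP that holds `A[a,c]` for the subproblem of level `i` with second coordinate `y`. -/
def homeA {m : ℕ} (π : Layout m) (i y : ℕ) (a c : Fin (2 ^ m)) : Fin (2 ^ (2 * m)) :=
  if i = 0 then π (a, c) else spread m i (seg i (blk i a) y (blk i c)) a c

/-- The VP that holds `B[c,b]` for the subproblem of level `i` with first coordinate `x`. -/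
def homeB {m : ℕ} (π : Layout m) (i x : ℕ) (c b : Fin (2 ^ m)) : Fin (2 ^ (2 * m)) :=
  if i = 0 then π (c, b) else spread m i (seg i x (blk i b) (blk i c)) c b

/-- The VP responsible for the entry `(a, b)` of the product computed by the subproblem of level
`i` with third coordinate `z`. -/
def homeC {m : ℕ} (π : Layout m) (i z : ℕ) (a b : Fin (2 ^ m)) : Fin (2 ^ (2 * m)) :=
  if i = 0 then π (a, b) else spread m i (seg i (blk i a) (blk i b) z) a b

/-- Register names: the copies of the entries of `A` and `B` and the entries of the products for the
subproblems of level `i`, one auxiliary register, and registers for dummy messages. -/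
inductive Reg (m : ℕ) where
  | A (i y : ℕ) (a c : Fin (2 ^ m)) : Reg m
  | B (i x : ℕ) (c b : Fin (2 ^ m)) : Reg m
  | C (i z : ℕ) (a b : Fin (2 ^ m)) : Reg m
  | tmp : Reg m
  | dummy (t : ℕ) : Reg m

/-- Index set of families of messages: two matrix indices and a block index. -/
def triples (m i : ℕ) : Finset (Fin (2 ^ m) × Fin (2 ^ m) × ℕ) :=
  Finset.univ ×ˢ (Finset.univ ×ˢ Finset.range (2 ^ i))

open Classical in
/-- The dummy messages of a `3i`-superstep: `2 ^ i` from `VP_j` to `VP_(j + n / 2 ^ (3 i + 1))`, for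
`0 ≤ j < n / 2 ^ (3 i + 1)`. -/
noncomputable def dummies (m i : ℕ) : Finset (Message (2 * m) (Reg m)) :=
  (Finset.range (2 ^ (2 * m) / 2 ^ (3 * i + 1)) ×ˢ Finset.range (2 ^ i)).image fun w =>
    ⟨Fin.ofNat _ w.1, Fin.ofNat _ (w.1 + 2 ^ (2 * m) / 2 ^ (3 * i + 1)), .dummy w.2, .dummy w.2⟩

open Classical in
/-- Replication of the inputs: every entry of `A` and `B` held for a subproblem of level `i` is
sent to the two subproblems of level `i + 1` that need it. -/
noncomputable def distMsgs {m : ℕ} (πA πB : Layout m) (i : ℕ) :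
    Finset (Message (2 * m) (Reg m)) :=
  ((triples m (i + 1)).image fun w =>
      ⟨homeA πA i (w.2.2 / 2) w.1 w.2.1, homeA πA (i + 1) w.2.2 w.1 w.2.1,
        .A i (w.2.2 / 2) w.1 w.2.1, .A (i + 1) w.2.2 w.1 w.2.1⟩) ∪
    ((triples m (i + 1)).image fun w =>
      ⟨homeB πB i (w.2.2 / 2) w.1 w.2.1, homeB πB (i + 1) w.2.2 w.1 w.2.1,
        .B i (w.2.2 / 2) w.1 w.2.1, .B (i + 1) w.2.2 w.1 w.2.1⟩) ∪
    dummies m i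

open Classical in
/-- Collection of the products: every entry of the products of level `i + 1` is sent to
the VP responsible for the corresponding entry of the product of level `i`. -/
noncomputable def collMsgs {m : ℕ} (πC : Layout m) (i : ℕ) :
    Finset (Message (2 * m) (Reg m)) :=
  ((triples m (i + 1)).image fun w =>
      ⟨homeC πC (i + 1) w.2.2 w.1 w.2.1, homeC πC i (w.2.2 / 2) w.1 w.2.1,
        .C (i + 1) w.2.2 w.1 w.2.1, .C (i + 1) w.2.2 w.1 w.2.1⟩) ∪
    dummies m i

/-- The operations that produce the entry `(a, b)` of the product of the subproblem of level `i`
with third coordinate `z`: at the last level the classical algorithm, above it the sum of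
two collected values. -/
def entryCode {m : ℕ} (i z : ℕ) (a b : Fin (2 ^ m)) : List (Instr (Reg m)) :=
  if i = levels m then
    Instr.zero (.C i z a b) :: ((List.finRange (2 ^ m)).filter fun c => blk i c = z).flatMap fun c =>
      [.mul .tmp (.A i (blk i b) a c) (.B i (blk i a) c b),
        .add (.C i z a b) (.C i z a b) .tmp]
  else [.add (.C i z a b) (.C (i + 1) (2 * z) a b) (.C (i + 1) (2 * z + 1) a b)]

/-- The operations of VP `r` that produce all entries of products of level `i` that it is
responsible for. -/
def prodCode {m : ℕ} (πC : Layout m) (i : ℕ) (r : Fin (2 ^ (2 * m))) : List (Instr (Reg m)) :=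
  (List.range (2 ^ i)).flatMap fun z =>
    (List.finRange (2 ^ m)).flatMap fun a =>
      (List.finRange (2 ^ m)).flatMap fun b =>
        if homeC πC i z a b = r then entryCode i z a b else []

theorem seg_succ_div (i x y z : ℕ) : seg (i + 1) x y z / 8 = seg i (x / 2) (y / 2) (z / 2) := by
  simp only [seg]
  omega

theorem seg_lt (i x y z : ℕ) : seg i x y z < 8 ^ i := by
  induction i generalizing x y z with
  | zero => simp [seg]
  | succ i ih =>
    have := ih (x / 2) (y / 2) (z / 2)
    simp only [seg, pow_succ]
    omega

theorem offset_lt {m : ℕ} (i : ℕ) (a b : Fin (2 ^ m)) :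
    a.val % 2 ^ (m - i) * 2 ^ (m - i) + b.val % 2 ^ (m - i) < 4 ^ (m - i) := by
  have hs : 0 < 2 ^ (m - i) := by positivity
  have h1 := Nat.mod_lt a.val hs
  have h2 := Nat.mod_lt b.val hs
  have h4 : 4 ^ (m - i) = 2 ^ (m - i) * 2 ^ (m - i) := by
    rw [← mul_pow]
    norm_num
  rw [h4]
  nlinarith

theorem spread_val {m i g : ℕ} (hi : i ≤ m) (hg : g < 8 ^ i) (a b : Fin (2 ^ m)) :
    (spread m i g a b).val = (g * 4 ^ (m - i) +
      (a.val % 2 ^ (m - i) * 2 ^ (m - i) + b.val % 2 ^ (m - i))) / 2 ^ i := by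
  have ho := offset_lt i a b
  rw [spread, Fin.val_ofNat]
  apply Nat.mod_eq_of_lt
  rw [Nat.div_lt_iff_lt_mul (by positivity)]
  have e : 2 ^ (2 * m) * 2 ^ i = 8 ^ i * 4 ^ (m - i) := by
    rw [show (8 : ℕ) = 2 ^ 3 by norm_num, show (4 : ℕ) = 2 ^ 2 by norm_num, ← pow_mul, ← pow_mul,
      ← pow_add, ← pow_add]
    congr 1
    omega
  rw [e]
  nlinarith [Nat.mul_le_mul_right (4 ^ (m - i)) (Nat.succ_le_of_lt hg)]

/-- The entries of a subproblem of level `i` lie in its segment. -/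
theorem spread_div {m i g : ℕ} (hi : i ≤ m) (hi' : 3 * i ≤ 2 * m) (hg : g < 8 ^ i)
    (a b : Fin (2 ^ m)) : (spread m i g a b).val / 2 ^ (2 * m - 3 * i) = g := by
  have ho := offset_lt i a b
  rw [spread_val hi hg, Nat.div_div_eq_div_mul, ← pow_add]
  have e : 2 ^ (i + (2 * m - 3 * i)) = 4 ^ (m - i) := by
    rw [show (4 : ℕ) = 2 ^ 2 by norm_num, ← pow_mul]
    congr 1
    omega
  rw [e, add_comm, Nat.add_mul_div_right _ _ (by positivity), Nat.div_eq_of_lt ho, zero_add]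

/-- The entries of a subproblem of level `i + 1` lie in the segment of its parent. -/
theorem spread_succ_div {m i g : ℕ} (hi : i + 1 ≤ m) (hi' : 3 * i ≤ 2 * m) (hg : g < 8 ^ (i + 1))
    (a b : Fin (2 ^ m)) : (spread m (i + 1) g a b).val / 2 ^ (2 * m - 3 * i) = g / 8 := by
  have ho := offset_lt (i + 1) a b
  rw [spread_val hi hg, Nat.div_div_eq_div_mul, ← pow_add]
  have e : 2 ^ (i + 1 + (2 * m - 3 * i)) = 4 ^ (m - (i + 1)) * 8 := by
    rw [show (4 : ℕ) = 2 ^ 2 by norm_num, show (8 : ℕ) = 2 ^ 3 by norm_num, ← pow_mul, ← pow_add]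
    congr 1
    omega
  rw [e, ← Nat.div_div_eq_div_mul, add_comm, Nat.add_mul_div_right _ _ (by positivity),
    Nat.div_eq_of_lt ho, zero_add]

theorem blk_succ {m i : ℕ} (hi : i + 1 ≤ m) (a : Fin (2 ^ m)) : blk (i + 1) a / 2 = blk i a := by
  rw [blk, blk, Nat.div_div_eq_div_mul, ← pow_succ]
  congr 2
  omega

theorem level_le {m i : ℕ} (h : i < levels m) : i + 1 ≤ m ∧ 3 * i + 1 ≤ 2 * m := by
  unfold levels at h
  omega

theorem zero_cluster {m : ℕ} (r : Fin (2 ^ (2 * m))) : r.val / 2 ^ (2 * m - 3 * 0) = 0 :=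
  Nat.div_eq_of_lt (by simp)

theorem homeA_cluster {m i : ℕ} (h : i < levels m) (π : Layout m) (y : ℕ) (a c : Fin (2 ^ m)) :
    (homeA π i (y / 2) a c).val / 2 ^ (2 * m - 3 * i) =
      (homeA π (i + 1) y a c).val / 2 ^ (2 * m - 3 * i) := by
  obtain ⟨h1, h2⟩ := level_le h
  rcases Nat.eq_zero_or_pos i with rfl | hi
  · rw [zero_cluster, zero_cluster]
  · rw [homeA, homeA, if_neg hi.ne', if_neg (by omega), spread_div (by omega) (by omega) (seg_lt ..),
      spread_succ_div h1 (by omega) (seg_lt ..), seg_succ_div, blk_succ h1, blk_succ h1]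

theorem homeB_cluster {m i : ℕ} (h : i < levels m) (π : Layout m) (x : ℕ) (c b : Fin (2 ^ m)) :
    (homeB π i (x / 2) c b).val / 2 ^ (2 * m - 3 * i) =
      (homeB π (i + 1) x c b).val / 2 ^ (2 * m - 3 * i) := by
  obtain ⟨h1, h2⟩ := level_le h
  rcases Nat.eq_zero_or_pos i with rfl | hi
  · rw [zero_cluster, zero_cluster]
  · rw [homeB, homeB, if_neg hi.ne', if_neg (by omega), spread_div (by omega) (by omega) (seg_lt ..),
      spread_succ_div h1 (by omega) (seg_lt ..), seg_succ_div, blk_succ h1, blk_succ h1]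

theorem homeC_cluster {m i : ℕ} (h : i < levels m) (π : Layout m) (z : ℕ) (a b : Fin (2 ^ m)) :
    (homeC π i (z / 2) a b).val / 2 ^ (2 * m - 3 * i) =
      (homeC π (i + 1) z a b).val / 2 ^ (2 * m - 3 * i) := by
  obtain ⟨h1, h2⟩ := level_le h
  rcases Nat.eq_zero_or_pos i with rfl | hi
  · rw [zero_cluster, zero_cluster]
  · rw [homeC, homeC, if_neg hi.ne', if_neg (by omega), spread_div (by omega) (by omega) (seg_lt ..),
      spread_succ_div h1 (by omega) (seg_lt ..), seg_succ_div, blk_succ h1, blk_succ h1]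

theorem dummies_bound {m i j : ℕ} (h : 3 * i + 1 ≤ 2 * m)
    (hj : j < 2 ^ (2 * m) / 2 ^ (3 * i + 1)) :
    j < 2 ^ (2 * m) ∧ j + 2 ^ (2 * m) / 2 ^ (3 * i + 1) < 2 ^ (2 * m) ∧
      j < 2 ^ (2 * m - 3 * i) ∧ j + 2 ^ (2 * m) / 2 ^ (3 * i + 1) < 2 ^ (2 * m - 3 * i) := by
  rw [Nat.pow_div h (by norm_num)] at hj ⊢
  have e : 2 ^ (2 * m - 3 * i) = 2 * 2 ^ (2 * m - (3 * i + 1)) := by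
    rw [← pow_succ']
    congr 1
    omega
  have l : 2 ^ (2 * m - 3 * i) ≤ 2 ^ (2 * m) := Nat.pow_le_pow_right (by norm_num) (by omega)
  omega

open Classical in
theorem dummies_cluster {m i : ℕ} (h : 3 * i + 1 ≤ 2 * m) (μ : Message (2 * m) (Reg m))
    (hμ : μ ∈ dummies m i) :
    μ.src.val / 2 ^ (2 * m - 3 * i) = μ.dst.val / 2 ^ (2 * m - 3 * i) := by
  obtain ⟨w, hw, rfl⟩ := Finset.mem_image.1 hμ
  obtain ⟨h1, h2, h3, h4⟩ := dummies_bound h (Finset.mem_range.1 (Finset.mem_product.1 hw).1)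
  simp only [Fin.val_ofNat]
  rw [Nat.mod_eq_of_lt h1, Nat.mod_eq_of_lt h2, Nat.div_eq_of_lt h3, Nat.div_eq_of_lt h4]

open Classical in
theorem dummies_tagged {m i : ℕ} (h : 3 * i + 1 ≤ 2 * m) :
    ∀ μ ∈ dummies m i, ∀ ν ∈ dummies m i, μ.dst = ν.dst → μ.dstReg = ν.dstReg → μ = ν := by
  intro μ hμ ν hν hd hr
  obtain ⟨v, hv, rfl⟩ := Finset.mem_image.1 hμ
  obtain ⟨w, hw, rfl⟩ := Finset.mem_image.1 hν
  obtain ⟨-, h2, -, -⟩ := dummies_bound h (Finset.mem_range.1 (Finset.mem_product.1 hv).1)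
  obtain ⟨-, h2', -, -⟩ := dummies_bound h (Finset.mem_range.1 (Finset.mem_product.1 hw).1)
  have hd' := congrArg Fin.val hd
  simp only [Fin.val_ofNat] at hd'
  rw [Nat.mod_eq_of_lt h2, Nat.mod_eq_of_lt h2'] at hd'
  have e1 : v.1 = w.1 := by omega
  have e2 : v.2 = w.2 := by simpa using hr
  rw [show v = w from Prod.ext e1 e2]

open Classical in
theorem dummies_reg {m i : ℕ} (μ : Message (2 * m) (Reg m)) (hμ : μ ∈ dummies m i) :
    ∃ t, μ.dstReg = .dummy t := by
  obtain ⟨w, -, rfl⟩ := Finset.mem_image.1 hμ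
  exact ⟨w.2, rfl⟩

open Classical in
/-- The `3i`-superstep that replicates the inputs of the subproblems of level `i`. -/
noncomputable def distStep {m : ℕ} (πA πB : Layout m) (i : ℕ) (h : i < levels m) :
    Step (2 * m) (Reg m) where
  label := 3 * i
  code _ := []
  msgs := distMsgs πA πB i
  tagged := by
    intro μ hμ ν hν hd hr
    have hl := (level_le h).2
    simp only [distMsgs, Finset.mem_union, Finset.mem_image] at hμ hν
    rcases hμ with (⟨v, -, rfl⟩ | ⟨v, -, rfl⟩) | hμ <;>
      rcases hν with (⟨w, -, rfl⟩ | ⟨w, -, rfl⟩) | hν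
    · simp only [Reg.A.injEq] at hr
      obtain ⟨-, h1, h2, h3⟩ := hr
      rw [h1, h2, h3]
    · simp at hr
    · obtain ⟨t, ht⟩ := dummies_reg ν hν
      simp [ht] at hr
    · simp at hr
    · simp only [Reg.B.injEq] at hr
      obtain ⟨-, h1, h2, h3⟩ := hr
      rw [h1, h2, h3]
    · obtain ⟨t, ht⟩ := dummies_reg ν hν
      simp [ht] at hr
    · obtain ⟨t, ht⟩ := dummies_reg μ hμ
      simp [ht] at hr
    · obtain ⟨t, ht⟩ := dummies_reg μ hμ
      simp [ht] at hr
    · exact dummies_tagged hl μ hμ ν hν hd hr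
  cluster := by
    intro μ hμ
    simp only [distMsgs, Finset.mem_union, Finset.mem_image] at hμ
    rcases hμ with (⟨w, -, rfl⟩ | ⟨w, -, rfl⟩) | hμ
    · exact homeA_cluster h πA _ _ _
    · exact homeB_cluster h πB _ _ _
    · exact dummies_cluster (level_le h).2 μ hμ

open Classical in
/-- The `3i`-superstep in which the products of level `i + 1` are computed and collected for
level `i`. -/
noncomputable def collStep {m : ℕ} (πC : Layout m) (i : ℕ) (h : i < levels m) :
    Step (2 * m) (Reg m) where
  label := 3 * i
  code := prodCode πC (i + 1)
  msgs := collMsgs πC i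
  tagged := by
    intro μ hμ ν hν hd hr
    have hl := (level_le h).2
    simp only [collMsgs, Finset.mem_union, Finset.mem_image] at hμ hν
    rcases hμ with ⟨v, -, rfl⟩ | hμ <;> rcases hν with ⟨w, -, rfl⟩ | hν
    · simp only [Reg.C.injEq] at hr
      obtain ⟨-, h1, h2, h3⟩ := hr
      rw [h1, h2, h3]
    · obtain ⟨t, ht⟩ := dummies_reg ν hν
      simp [ht] at hr
    · obtain ⟨t, ht⟩ := dummies_reg μ hμ
      simp [ht] at hr
    · exact dummies_tagged hl μ hμ ν hν hd hr
  cluster := by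
    intro μ hμ
    simp only [collMsgs, Finset.mem_union, Finset.mem_image] at hμ
    rcases hμ with ⟨w, -, rfl⟩ | hμ
    · exact (homeC_cluster h πC _ _ _).symm
    · exact dummies_cluster (level_le h).2 μ hμ

/-- The last `0`-superstep, in which the output matrix is computed from the collected values. -/
noncomputable def lastStep {m : ℕ} (πC : Layout m) (h : 0 < levels m) :
    Step (2 * m) (Reg m) where
  label := 0
  code := prodCode πC 0
  msgs := dummies m 0
  tagged := dummies_tagged (level_le h).2
  cluster := dummies_cluster (level_le h).2

open Classical in
/-- The recursive 8-way matrix multiplication algorithm on `M(n)`, `n = 2 ^ (2 * m)`, for inputs `A`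
and `B` distributed according to `πA` and `πB` and the output distributed according to `πC`. -/
noncomputable def algorithm {m : ℕ} (hm : 1 ≤ m) (πA πB πC : Layout m) :
    Algorithm (2 * m) (2 ^ m) where
  Reg := Reg m
  steps :=
    (List.finRange (levels m)).map (fun i : Fin (levels m) => distStep πA πB i i.isLt) ++
      (List.finRange (levels m)).reverse.map (fun i : Fin (levels m) => collStep πC i i.isLt) ++
      [lastStep πC (by unfold levels; omega)]
  input
    | r, .A 0 0 a c => if πA (a, c) = r then some (.A a c) else none
    | r, .B 0 0 c b => if πB (c, b) = r then some (.B c b) else none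
    | _, _ => none
  output a b := (πC (a, b), .C 0 0 a b)

end MM

/-! ### Execution of steps -/

/-! Upper bound. At level `i` each of the three matrix families has `8 ^ i * 4 ^ (m - i) = n * 2 ^
i` entries in all, spread evenly, so a PE holds at most `2 ^ i` of each. Hence every `3i`-superstep
has at most `5 * 2 ^ i` messages per sender and per receiver (`IsRegular`). Folding onto `p = 2 ^ k`
PEs multiplies this by at most `n / p`, and only levels with `3 * i < k` still communicate. The
geometric sum is of order `2 ^ (k / 3) * n / p = n / p ^ (2/3)`, with `O(log p)` supersteps.
Conversely, the dummy messages force degree at least `2 ^ i * n / 2 ^ j` on `2 ^ j` PEs whenever `3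
* i < j`; comparing the two bounds superstep by superstep gives wiseness with `α = 1 / 5`.

Lower bound. An algorithm correct over every semiring is run on generic matrices over the free
semiring. Coefficients are natural numbers, so nothing cancels. Tracing an output entry backwards
through partial sums shows that each term `A[i,l] * B[l,j]` is literally multiplied at some PE,
which either owns the output entry `(i, j)` or sends a partial sum of it (`Solves.exists_computes`);
the operands were there initially or were received (`exists_input`). One message can serve only one
input entry, or one output entry. So, with `D` the sum of the degrees, the three projections of the
set of terms assigned to a PE are at most its own entries of `A`, `B`, `C`, plus `D` each.
Loomis-Whitney and the inequality of the means bound its share of the terms by `(s + h) ^ (3/2)`,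
where `s` is its share of the data and `h = D / n`. Data shares sum to at most 1 and term shares to
1, while balance keeps each term share at most `1 / 2`; by the superlinearity of `x ^ (3/2)` this
forces `h` to be at least `p ^ (-2/3) / 50` (`surplus_bound`, `totalDegree_bound`).

Membership. Correctness, absence of replication and an exactly even share of terms per PE are each
preserved by folding. For the algorithm, correctness follows from two invariants: inputs are
available going down the recursion (`HasInputs`), and products are computable going up (`Ready`). A
multiplication of two given entries can only occur at the PE that is home to the corresponding
product entry of the last level, which bounds the share of each PE. -/

theorem runCode_append {Reg S : Type} [Semiring S] (c₁ c₂ : List (Instr Reg)) (mem : Reg → S) :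
    runCode (c₁ ++ c₂) mem = runCode c₂ (runCode c₁ mem) :=
  List.foldl_append

theorem runCode_cons {Reg S : Type} [Semiring S] (a : Instr Reg) (c : List (Instr Reg))
    (mem : Reg → S) : runCode (a :: c) mem = runCode c (a.exec mem) :=
  rfl

@[simp] theorem runCode_nil {Reg S : Type} [Semiring S] (mem : Reg → S) :
    runCode ([] : List (Instr Reg)) mem = mem :=
  rfl

namespace Step

variable {k : ℕ} {Reg S : Type} [Semiring S]

/-- The choice in `Step.exec` is harmless: `tagged` leaves only one message for each pair of
receiver and register. -/
theorem exec_of_mem (mem : Fin (2 ^ k) → Reg → S) (st : Step k Reg) {μ : Message k Reg}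
    (hμ : μ ∈ st.msgs) :
    Step.exec mem st μ.dst μ.dstReg = runCode (st.code μ.src) (mem μ.src) μ.srcReg := by
  have h : ∃ ν ∈ st.msgs, ν.dst = μ.dst ∧ ν.dstReg = μ.dstReg := ⟨μ, hμ, rfl, rfl⟩
  have e : h.choose = μ :=
    st.tagged _ h.choose_spec.1 _ hμ h.choose_spec.2.1 h.choose_spec.2.2
  simp only [Step.exec]
  rw [dif_pos h, e]

theorem exec_of_not_mem (mem : Fin (2 ^ k) → Reg → S) (st : Step k Reg) {r : Fin (2 ^ k)} {d : Reg}
    (h : ∀ μ ∈ st.msgs, μ.dst = r → μ.dstReg ≠ d) :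
    Step.exec mem st r d = runCode (st.code r) (mem r) d := by
  simp only [Step.exec]
  rw [dif_neg]
  rintro ⟨μ, hμ, h1, h2⟩
  exact h μ hμ h1 h2

/-- A value held after a step was either received or produced locally. -/
theorem exec_cases (mem : Fin (2 ^ k) → Reg → S) (st : Step k Reg) (r : Fin (2 ^ k)) (d : Reg) :
    (∃ μ ∈ st.msgs, μ.dst = r ∧ μ.dstReg = d ∧
      Step.exec mem st r d = runCode (st.code μ.src) (mem μ.src) μ.srcReg) ∨
    Step.exec mem st r d = runCode (st.code r) (mem r) d := by
  by_cases h : ∃ μ ∈ st.msgs, μ.dst = r ∧ μ.dstReg = d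
  · obtain ⟨μ, hμ, rfl, rfl⟩ := h
    exact .inl ⟨μ, hμ, rfl, rfl, exec_of_mem mem st hμ⟩
  · refine .inr (exec_of_not_mem mem st fun μ hμ h1 h2 => h ⟨μ, hμ, h1, h2⟩)

end Step

/-! ### Folding preserves the semantics -/

theorem runCode_rename_self {ι Reg S : Type} [Semiring S] (r : ι) (code : List (Instr Reg))
    (M : ι × Reg → S) (d : Reg) :
    runCode (code.map (Instr.rename (Prod.mk r))) M (r, d) =
      runCode code (fun d => M (r, d)) d := by
  induction code generalizing M with
  | nil => rfl
  | cons a c ih =>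
    rw [List.map_cons, runCode_cons, runCode_cons, ih]
    congr 1
    ext e
    cases a <;> simp only [Instr.rename, Instr.exec, Function.update_apply] <;> split_ifs <;> simp_all

theorem runCode_rename_of_ne {ι Reg S : Type} [Semiring S] {r r' : ι} (hr : r' ≠ r)
    (code : List (Instr Reg)) (M : ι × Reg → S) (d : Reg) :
    runCode (code.map (Instr.rename (Prod.mk r))) M (r', d) = M (r', d) := by
  induction code generalizing M with
  | nil => rfl
  | cons a c ih =>
    rw [List.map_cons, runCode_cons, ih]
    cases a <;> simp [Instr.rename, Instr.exec, hr]

namespace Algorithm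

variable {k N : ℕ}

theorem runCode_flatMap_of_not_mem {ι Reg S : Type} [Semiring S] (p : ι → Prop) [DecidablePred p]
    (code : ι → List (Instr Reg)) (l : List ι) (M : ι × Reg → S) {r : ι} (hr : r ∉ l) (d : Reg) :
    runCode (l.flatMap fun r => if p r then (code r).map (Instr.rename (Prod.mk r)) else []) M
      (r, d) = M (r, d) := by
  induction l generalizing M with
  | nil => rfl
  | cons a l ih =>
    simp only [List.mem_cons, not_or] at hr
    rw [List.flatMap_cons, runCode_append, ih _ hr.2]
    split_ifs
    · exact runCode_rename_of_ne hr.1 _ _ _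
    · rfl

theorem runCode_flatMap_of_mem {ι Reg S : Type} [Semiring S] (p : ι → Prop) [DecidablePred p]
    (code : ι → List (Instr Reg)) (l : List ι) (hl : l.Nodup) (M : ι × Reg → S) {r : ι}
    (hr : r ∈ l) (hp : p r) (d : Reg) :
    runCode (l.flatMap fun r => if p r then (code r).map (Instr.rename (Prod.mk r)) else []) M
      (r, d) = runCode (code r) (fun d => M (r, d)) d := by
  obtain ⟨l₁, l₂, rfl⟩ := List.append_of_mem hr
  have h1 : r ∉ l₁ := fun h => (List.nodup_append.1 hl).2.2 r h r (by simp) rfl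
  have h2 : r ∉ l₂ := (List.nodup_cons.1 (List.nodup_append.1 hl).2.1).1
  rw [List.flatMap_append, List.flatMap_cons, runCode_append, runCode_append,
    runCode_flatMap_of_not_mem p code l₂ _ h2, if_pos hp, runCode_rename_self]
  congr 1
  ext e
  exact runCode_flatMap_of_not_mem p code l₁ _ h1 e

/-- The memory of a folded algorithm contains the memories of the PEs of the blocks. -/
def Simulates {k j : ℕ} (hj : j ≤ k) {Reg S : Type} (M : Fin (2 ^ j) → Fin (2 ^ k) × Reg → S)
    (mem : Fin (2 ^ k) → Reg → S) : Prop :=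
  ∀ r d, M (block hj r) (r, d) = mem r d

theorem Simulates.code {j : ℕ} {hj : j ≤ k} {Reg S : Type} [Semiring S]
    {M : Fin (2 ^ j) → Fin (2 ^ k) × Reg → S} {mem : Fin (2 ^ k) → Reg → S}
    (h : Simulates hj M mem) (st : Step k Reg) (r : Fin (2 ^ k)) (d : Reg) :
    runCode ((foldStep hj st).code (block hj r)) (M (block hj r)) (r, d) =
      runCode (st.code r) (mem r) d := by
  have := runCode_flatMap_of_mem (fun r' => block hj r' = block hj r) st.code _
    (List.nodup_finRange (2 ^ k)) (M (block hj r)) (List.mem_finRange r) rfl d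
  refine this.trans ?_
  congr 1
  ext e
  exact h r e

/-- Registers of the folded machine carry the index of the original PE. Hence blocks do not
interfere in local code, and a folded message arrives in register `(r, d)` exactly when an original
one arrives in register `d` of PE `r`; messages inside a block survive as local copies. -/
theorem Simulates.exec {j : ℕ} {hj : j ≤ k} {Reg S : Type} [Semiring S]
    {M : Fin (2 ^ j) → Fin (2 ^ k) × Reg → S} {mem : Fin (2 ^ k) → Reg → S}
    (h : Simulates hj M mem) (st : Step k Reg) :
    Simulates hj (Step.exec M (foldStep hj st)) (Step.exec mem st) := by
  classical
  intro r d
  by_cases hr : ∃ μ ∈ st.msgs, μ.dst = r ∧ μ.dstReg = d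
  · obtain ⟨μ, hμ, rfl, rfl⟩ := hr
    rw [Step.exec_of_mem mem st hμ]
    have := Step.exec_of_mem M (foldStep hj st) (Finset.mem_image_of_mem _ hμ)
    exact this.trans (h.code st μ.src μ.srcReg)
  · rw [Step.exec_of_not_mem mem st fun μ hμ h1 h2 => hr ⟨μ, hμ, h1, h2⟩,
      Step.exec_of_not_mem M (foldStep hj st), h.code]
    intro μ hμ _ h2
    obtain ⟨ν, hν, rfl⟩ := Finset.mem_image.1 hμ
    exact hr ⟨ν, hν, congrArg Prod.fst h2, congrArg Prod.snd h2⟩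

theorem Simulates.foldl {j : ℕ} {hj : j ≤ k} {Reg S : Type} [Semiring S] (l : List (Step k Reg))
    {M : Fin (2 ^ j) → Fin (2 ^ k) × Reg → S} {mem : Fin (2 ^ k) → Reg → S}
    (h : Simulates hj M mem) :
    Simulates hj ((l.map (foldStep hj)).foldl Step.exec M) (l.foldl Step.exec mem) := by
  induction l generalizing M mem with
  | nil => exact h
  | cons st l ih => exact ih (h.exec st)

theorem simulates_start (𝒜 : Algorithm k N) {j : ℕ} (hj : j ≤ k) {S : Type} [Semiring S]
    (inst : Entry N → S) : Simulates hj ((𝒜.fold hj).start inst) (𝒜.start inst) := by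
  intro r d
  simp [start, fold]

theorem Solves.fold {𝒜 : Algorithm k N} (h : 𝒜.Solves) {j : ℕ} (hj : j ≤ k) :
    (𝒜.fold hj).Solves := by
  intro S _ A B a b
  rw [← h S A B a b]
  exact (simulates_start 𝒜 hj _).foldl 𝒜.steps _ _

theorem NoReplication.fold {𝒜 : Algorithm k N} (h : 𝒜.NoReplication) {j : ℕ} (hj : j ≤ k) :
    (𝒜.fold hj).NoReplication := by
  rintro e R R' ⟨r, d⟩ ⟨r', d'⟩ h1 h2
  simp only [Algorithm.fold] at h1 h2
  split_ifs at h1 with e1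
  split_ifs at h2 with e2
  obtain ⟨rfl, rfl⟩ := h e r r' d d' h1 h2
  exact ⟨e1.symm.trans e2, rfl⟩

/-! ### Terms computed by a folded algorithm -/

theorem flatMap_eq_append_cons {α β : Type*} {f : α → List β} {l : List α} {c₁ c₂ : List β} {b : β}
    (h : l.flatMap f = c₁ ++ b :: c₂) :
    ∃ l₁ a l₂ e₁ e₂, l = l₁ ++ a :: l₂ ∧ f a = e₁ ++ b :: e₂ ∧ c₁ = l₁.flatMap f ++ e₁ := by
  induction l generalizing c₁ with
  | nil => simp at h
  | cons a l ih =>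
    rw [List.flatMap_cons] at h
    rcases List.append_eq_append_iff.1 h with ⟨e, h1, h2⟩ | ⟨e, h1, h2⟩
    · obtain ⟨l₁, a', l₂, e₁, e₂, rfl, h4, h5⟩ := ih h2
      exact ⟨a :: l₁, a', l₂, e₁, e₂, rfl, h4, by rw [h1, h5]; simp⟩
    -- If the remainder `e` is empty, the cut falls exactly at the end of `f a`, and `b` belongs to
    -- a later piece.
    · rcases e with _ | ⟨b', e⟩
      · obtain ⟨l₁, a', l₂, e₁, e₂, rfl, h4, h5⟩ := ih (c₁ := []) h2.symm
        refine ⟨a :: l₁, a', l₂, e₁, e₂, rfl, h4, ?_⟩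
        rw [List.flatMap_cons, List.append_assoc, ← h5, h1]
        simp
      · obtain ⟨rfl, h3⟩ := List.cons_eq_cons.1 h2
        exact ⟨[], a, l, c₁, e, rfl, h1, rfl⟩

/-- A multiplication in the folded code stems from the code of one original PE. The code of other
PEs of the block that precedes it writes only to their own registers, so the operands have the same
values as in the original run. -/
theorem Computes.of_fold {𝒜 : Algorithm k N} {j : ℕ} {hj : j ≤ k} {R : Fin (2 ^ j)}
    {t : Fin N × Fin N × Fin N} (h : (𝒜.fold hj).Computes R t) :
    ∃ r, block hj r = R ∧ 𝒜.Computes r t := by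
  classical
  obtain ⟨before, after, st, code₁, code₂, d, x, y, h1, h2, h3, h4⟩ := h
  obtain ⟨b, l, hs, rfl, hl⟩ := List.map_eq_append_iff.1 h1
  obtain ⟨st, a, rfl, rfl, rfl⟩ := List.map_eq_cons_iff.1 hl
  obtain ⟨l₁, r, l₂, e₁, e₂, h5, h6, rfl⟩ := flatMap_eq_append_cons h2
  split_ifs at h6 with hr
  swap
  · simp at h6
  subst hr
  obtain ⟨f₁, f₂, h7, rfl, h8⟩ := List.map_eq_append_iff.1 h6
  obtain ⟨c, f₂, rfl, h9, rfl⟩ := List.map_eq_cons_iff.1 h8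
  have hl₁ : r ∉ l₁ := by
    have := List.nodup_finRange (2 ^ k)
    rw [h5] at this
    exact fun h => (List.nodup_append.1 this).2.2 r h r (by simp) rfl
  have key : ∀ z, runCode ((l₁.flatMap fun r' => if block hj r' = block hj r then
        (st.code r').map (Instr.rename (Prod.mk r')) else []) ++
          f₁.map (Instr.rename (Prod.mk r)))
        ((b.map (foldStep hj)).foldl Step.exec ((𝒜.fold hj).start (FreeAlgebra.ι ℕ)) (block hj r))
        (r, z) = runCode f₁ (b.foldl Step.exec (𝒜.start (FreeAlgebra.ι ℕ)) r) z := by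
    intro z
    rw [runCode_append, runCode_rename_self]
    congr 1
    ext e
    refine (runCode_flatMap_of_not_mem _ _ _ _ hl₁ e).trans ?_
    exact (simulates_start 𝒜 hj _).foldl b r e
  cases c with
  | mul d' x' y' =>
    simp only [Instr.rename] at h9
    obtain ⟨rfl, rfl, rfl⟩ := h9
    exact ⟨r, rfl, b, a, st, f₁, f₂, d', x', y', hs, h7, (key x').symm.trans h3,
      (key y').symm.trans h4⟩
  | zero _ => simp [Instr.rename] at h9
  | one _ => simp [Instr.rename] at h9
  | add _ _ _ => simp [Instr.rename] at h9

/-- The PEs of `M(2 ^ k)` hosted by a PE of `M(2 ^ j)`. -/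
theorem card_block {j : ℕ} (hj : j ≤ k) (R : Fin (2 ^ j)) :
    (Finset.univ.filter fun r : Fin (2 ^ k) => block hj r = R).card ≤ 2 ^ (k - j) := by
  have : (Finset.univ.filter fun r : Fin (2 ^ k) => block hj r = R).card ≤
      (Finset.range (2 ^ (k - j))).card := by
    apply Finset.card_le_card_of_injOn (fun r => r.val % 2 ^ (k - j))
    · intro r _
      simpa using Nat.mod_lt _ (by positivity)
    · intro r hr r' hr' h
      simp only [Finset.coe_filter, Finset.mem_univ, true_and, Set.mem_ofPred_eq] at hr hr'
      have h1 : r.val / 2 ^ (k - j) = r'.val / 2 ^ (k - j) :=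
        congrArg Fin.val (hr.trans hr'.symm)
      apply Fin.ext
      rw [← Nat.div_add_mod r.val (2 ^ (k - j)), ← Nat.div_add_mod r'.val (2 ^ (k - j)), h1]
      exact congrArg _ h
  simpa using this

/-- The multiplicative terms are evenly distributed among the PEs. -/
def EvenTerms (𝒜 : Algorithm k N) : Prop :=
  ∀ r : Fin (2 ^ k), {t | 𝒜.Computes r t}.ncard * 2 ^ k ≤ N ^ 3

theorem EvenTerms.fold {𝒜 : Algorithm k N} (h : 𝒜.EvenTerms) {j : ℕ} (hj : j ≤ k) :
    (𝒜.fold hj).EvenTerms := by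
  classical
  intro R
  have h1 : {t | (𝒜.fold hj).Computes R t}.ncard ≤
      ∑ r ∈ Finset.univ.filter (fun r : Fin (2 ^ k) => block hj r = R),
        {t | 𝒜.Computes r t}.ncard := by
    refine le_trans (Set.ncard_le_ncard (t := ⋃ r ∈ Finset.univ.filter
      (fun r : Fin (2 ^ k) => block hj r = R), {t | 𝒜.Computes r t}) ?_ (Set.toFinite _)) ?_
    · intro t ht
      obtain ⟨r, hr, hc⟩ := Computes.of_fold ht
      simp only [Set.mem_iUnion]
      exact ⟨r, by simpa using hr, hc⟩
    · exact Finset.set_ncard_biUnion_le _ _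
  have h2 : (∑ r ∈ Finset.univ.filter (fun r : Fin (2 ^ k) => block hj r = R),
      {t | 𝒜.Computes r t}.ncard) * 2 ^ k ≤ 2 ^ (k - j) * N ^ 3 := by
    rw [Finset.sum_mul]
    refine (Finset.sum_le_card_nsmul _ _ _ fun r _ => h r).trans ?_
    exact Nat.mul_le_mul_right _ (card_block hj R)
  have e : 2 ^ k = 2 ^ (k - j) * 2 ^ j := by rw [← pow_add]; congr 1; omega
  have h3 := (Nat.mul_le_mul_right (2 ^ k) h1).trans h2
  rw [e, mul_left_comm] at h3
  exact Nat.le_of_mul_le_mul_left h3 (by positivity)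

theorem EvenTerms.balancedTerms {𝒜 : Algorithm k N} (h : 𝒜.EvenTerms) : 𝒜.BalancedTerms := by
  intro r
  have h1 : ({t | 𝒜.Computes r t}.ncard : ℝ) * 2 ^ k ≤ (N : ℝ) ^ 3 := by exact_mod_cast h r
  rw [le_div_iff₀ (lt_min (by positivity) (by norm_num))]
  exact (mul_le_mul_of_nonneg_left (min_le_left _ _) (Nat.cast_nonneg _)).trans h1

/-- The detour through `EvenTerms` is needed because summing the bound of `BalancedTerms`, capped at
`11 ^ 3`, over a block is too weak for the folding; the uncapped bound scales exactly. -/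
theorem inClass_of_evenTerms {𝒜 : Algorithm k N} (h1 : 𝒜.Solves) (h2 : 𝒜.NoReplication)
    (h3 : 𝒜.EvenTerms) : 𝒜.InClass :=
  ⟨⟨h1, h2, h3.balancedTerms⟩, fun _ _ hj =>
    ⟨h1.fold hj.le, h2.fold hj.le, (h3.fold hj.le).balancedTerms⟩⟩

end Algorithm

/-! ### Coefficients in the free semiring -/

/-- The coefficient of a word in an element of the free semiring. -/
noncomputable def FreeAlgebra.coef {X : Type} (x : FreeAlgebra ℕ X) (w : FreeMonoid X) : ℕ :=
  (FreeAlgebra.equivMonoidAlgebraFreeMonoid x).coeff w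

namespace FreeAlgebra

variable {X : Type}

theorem coef_ext {x y : FreeAlgebra ℕ X} (h : ∀ w, coef x w = coef y w) : x = y := by
  apply FreeAlgebra.equivMonoidAlgebraFreeMonoid.injective
  ext w
  exact h w

@[simp] theorem coef_add (x y : FreeAlgebra ℕ X) (w : FreeMonoid X) :
    coef (x + y) w = coef x w + coef y w := by
  simp [coef]

@[simp] theorem coef_zero (w : FreeMonoid X) : coef (0 : FreeAlgebra ℕ X) w = 0 := by
  simp [coef]

theorem coef_sum {ι : Type} (s : Finset ι) (f : ι → FreeAlgebra ℕ X) (w : FreeMonoid X) :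
    coef (∑ i ∈ s, f i) w = ∑ i ∈ s, coef (f i) w := by
  classical
  induction s using Finset.induction_on with
  | empty => simp
  | insert a s ha ih => rw [Finset.sum_insert ha, Finset.sum_insert ha, coef_add, ih]

open Classical in
theorem coef_one (w : FreeMonoid X) :
    coef (1 : FreeAlgebra ℕ X) w = if w = 1 then 1 else 0 := by
  simp [coef, MonoidAlgebra.one_def, Finsupp.single_apply, eq_comm]

theorem equiv_ι (x : X) : FreeAlgebra.equivMonoidAlgebraFreeMonoid (FreeAlgebra.ι ℕ x) =
    MonoidAlgebra.single (FreeMonoid.of x) 1 := by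
  simp [FreeAlgebra.equivMonoidAlgebraFreeMonoid]

open Classical in
theorem coef_ι (x : X) (w : FreeMonoid X) :
    coef (FreeAlgebra.ι ℕ x) w = if w = FreeMonoid.of x then 1 else 0 := by
  simp [coef, equiv_ι, Finsupp.single_apply, eq_comm]

open Classical in
theorem coef_ι_mul_ι (x y : X) (w : FreeMonoid X) :
    coef (FreeAlgebra.ι ℕ x * FreeAlgebra.ι ℕ y) w =
      if w = FreeMonoid.of x * FreeMonoid.of y then 1 else 0 := by
  simp [coef, equiv_ι, Finsupp.single_apply, eq_comm]

/-- The coefficient of a product is a sum of natural numbers over all factorizations of the word;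
one summand is kept. -/
theorem coef_mul_le (x y : FreeAlgebra ℕ X) (u v : FreeMonoid X) :
    coef x u * coef y v ≤ coef (x * y) (u * v) := by
  classical
  by_cases hu : coef x u = 0
  · simp [hu]
  by_cases hv : coef y v = 0
  · simp [hv]
  simp only [coef, map_mul] at *
  rw [MonoidAlgebra.coeff_mul, Finsupp.sum]
  refine le_trans ?_ (Finset.single_le_sum (f := fun a => _) (fun _ _ => Nat.zero_le _)
    (Finsupp.mem_support_iff.2 hu))
  rw [Finsupp.sum]
  refine le_trans ?_ (Finset.single_le_sum (f := fun a => _) (fun _ _ => Nat.zero_le _)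
    (Finsupp.mem_support_iff.2 hv))
  simp

theorem exists_of_coef_mul_ne {x y : FreeAlgebra ℕ X} {w : FreeMonoid X}
    (h : coef (x * y) w ≠ 0) : ∃ u v, u * v = w ∧ coef x u ≠ 0 ∧ coef y v ≠ 0 := by
  classical
  simp only [coef, map_mul] at *
  rw [MonoidAlgebra.coeff_mul, Finsupp.sum] at h
  obtain ⟨u, hu, h⟩ := Finset.exists_ne_zero_of_sum_ne_zero h
  rw [Finsupp.sum] at h
  obtain ⟨v, hv, h⟩ := Finset.exists_ne_zero_of_sum_ne_zero h
  exact ⟨u, v, by_contra fun e => h (if_neg e), Finsupp.mem_support_iff.1 hu,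
    Finsupp.mem_support_iff.1 hv⟩

/-- `x` contains the word `M` and is a partial sum of `T`. -/
def PartOf (T : FreeAlgebra ℕ X) (M : FreeMonoid X) (x : FreeAlgebra ℕ X) : Prop :=
  (∀ w, coef x w ≤ coef T w) ∧ coef x M ≠ 0

variable {T : FreeAlgebra ℕ X} {M : FreeMonoid X}

theorem not_partOf_zero : ¬ PartOf T M 0 := fun h => h.2 (coef_zero M)

theorem not_partOf_one (hM : M ≠ 1) : ¬ PartOf T M 1 := fun h => h.2 (by rw [coef_one, if_neg hM])

theorem PartOf.of_add {x y : FreeAlgebra ℕ X} (h : PartOf T M (x + y)) :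
    PartOf T M x ∨ PartOf T M y := by
  obtain ⟨h1, h2⟩ := h
  simp only [coef_add] at h1 h2
  by_cases hx : coef x M = 0
  · exact .inr ⟨fun w => (Nat.le_add_left _ _).trans (h1 w), fun hy => h2 (by omega)⟩
  · exact .inl ⟨fun w => (Nat.le_add_right _ _).trans (h1 w), hx⟩

/-- Some factorization `u * v` of `M` occurs in the product. If `u` is empty, `x` has a constant
coefficient of at least 1, so `y` is dominated by `x * y` and hence by `T`, and it contains `M`;
symmetrically for `v`. -/
theorem PartOf.of_mul {x y : FreeAlgebra ℕ X} (h : PartOf T M (x * y)) :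
    PartOf T M x ∨ PartOf T M y ∨
      ∃ u v, u * v = M ∧ u ≠ 1 ∧ v ≠ 1 ∧ coef x u ≠ 0 ∧ coef y v ≠ 0 := by
  obtain ⟨u, v, rfl, hu, hv⟩ := exists_of_coef_mul_ne h.2
  by_cases hu1 : u = 1
  · subst hu1
    refine .inr (.inl ⟨fun w => ?_, by rwa [one_mul]⟩)
    have := (coef_mul_le x y 1 w).trans (h.1 _)
    rw [one_mul] at this
    exact le_trans (Nat.le_mul_of_pos_left _ (Nat.pos_of_ne_zero hu)) this
  by_cases hv1 : v = 1
  · subst hv1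
    refine .inl ⟨fun w => ?_, by rwa [mul_one]⟩
    have := (coef_mul_le x y w 1).trans (h.1 _)
    rw [mul_one] at this
    exact le_trans (Nat.le_mul_of_pos_right _ (Nat.pos_of_ne_zero hv)) this
  exact .inr (.inr ⟨u, v, rfl, hu1, hv1, hu, hv⟩)

theorem partOf_ι (x : X) : PartOf (FreeAlgebra.ι ℕ x) (FreeMonoid.of x) (FreeAlgebra.ι ℕ x) :=
  ⟨fun _ => le_rfl, by simp [coef_ι]⟩

/-- Used to charge a received message to a single input entry. -/
theorem PartOf.ι_congr {x y : X} {q : FreeAlgebra ℕ X} (h : PartOf T (FreeMonoid.of x) q)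
    (h' : PartOf (FreeAlgebra.ι ℕ y) M q) : x = y := by
  classical
  by_contra hxy
  have := h'.1 (FreeMonoid.of x)
  rw [coef_ι, if_neg (fun e => hxy (FreeMonoid.of_injective e))] at this
  exact h.2 (Nat.le_zero.1 this)

theorem of_mul_split {u v : FreeMonoid X} {x : X} (h : u * v = FreeMonoid.of x) :
    u = 1 ∨ v = 1 := by
  have h' : FreeMonoid.toList u ++ FreeMonoid.toList v = [x] := h
  rcases List.append_eq_cons_iff.1 h' with ⟨h1, -⟩ | ⟨l, h1, h2⟩
  · exact .inl h1
  · exact .inr (List.append_eq_nil_iff.1 h2.symm).2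

theorem of_mul_of_split {u v : FreeMonoid X} {x y : X} (hu : u ≠ 1) (hv : v ≠ 1)
    (h : u * v = FreeMonoid.of x * FreeMonoid.of y) :
    u = FreeMonoid.of x ∧ v = FreeMonoid.of y := by
  have h' : FreeMonoid.toList u ++ FreeMonoid.toList v = [x, y] := h
  rcases List.append_eq_cons_iff.1 h' with ⟨h1, -⟩ | ⟨l, h1, h2⟩
  · exact absurd h1 hu
  · rcases List.append_eq_cons_iff.1 h2.symm with ⟨h3, h4⟩ | ⟨l', h3, h4⟩
    · exact ⟨by rw [h3] at h1; exact h1, h4⟩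
    · exact absurd (List.append_eq_nil_iff.1 h4.symm).2 hv

theorem PartOf.of_mul_ι {x y : FreeAlgebra ℕ X} {e : X}
    (h : PartOf T (FreeMonoid.of e) (x * y)) :
    PartOf T (FreeMonoid.of e) x ∨ PartOf T (FreeMonoid.of e) y := by
  rcases h.of_mul with h | h | ⟨u, v, h, hu, hv, -⟩
  · exact .inl h
  · exact .inr h
  · exact ((of_mul_split h).elim hu hv).elim

end FreeAlgebra

/-! ### Values of the multiplicative terms -/

/-- The entry `(i, j)` of the product of the generic matrices. -/
noncomputable def genericProduct {N : ℕ} (i j : Fin N) : FreeAlgebra ℕ (Entry N) :=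
  ∑ l, FreeAlgebra.ι ℕ (Entry.A i l) * FreeAlgebra.ι ℕ (Entry.B l j)

/-- The word `A[i,l] B[l,j]`. -/
def termWord {N : ℕ} (i l j : Fin N) : FreeMonoid (Entry N) :=
  FreeMonoid.of (Entry.A i l) * FreeMonoid.of (Entry.B l j)

open FreeAlgebra

variable {N : ℕ}

theorem termWord_inj {i l j i' l' j' : Fin N} (h : termWord i l j = termWord i' l' j') :
    i = i' ∧ l = l' ∧ j = j' := by
  have h' : [Entry.A i l, Entry.B l j] = [Entry.A i' l', Entry.B l' j'] := h
  simp at h'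
  tauto

theorem termWord_ne_one (i l j : Fin N) : termWord i l j ≠ 1 := by
  intro h
  have h' : [Entry.A i l, Entry.B l j] = [] := h
  simp at h'

open Classical in
theorem coef_genericProduct (i j : Fin N) (w : FreeMonoid (Entry N)) :
    coef (genericProduct i j) w = if ∃ l, w = termWord i l j then 1 else 0 := by
  simp only [genericProduct, coef_sum, coef_ι_mul_ι]
  split_ifs with h
  · obtain ⟨l, rfl⟩ := h
    rw [Finset.sum_eq_single l]
    · simp [termWord]
    · intro b _ hb
      exact if_neg fun e => hb (termWord_inj (i := i) (j := j) e).2.1.symm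
    · simp
  · exact Finset.sum_eq_zero fun l _ => if_neg fun e => h ⟨l, e⟩

theorem partOf_genericProduct (i l j : Fin N) :
    PartOf (genericProduct i j) (termWord i l j) (genericProduct i j) := by
  classical
  refine ⟨fun _ => le_rfl, ?_⟩
  rw [coef_genericProduct, if_pos ⟨l, rfl⟩]
  exact one_ne_zero

/-- Used to charge a sent message to a single output entry. A partial sum may contain several terms,
so nothing is claimed about `l` and `l'`. -/
theorem PartOf.genericProduct_congr {i l j i' l' j' : Fin N} {q : FreeAlgebra ℕ (Entry N)}
    (h : PartOf (genericProduct i j) (termWord i l j) q)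
    (h' : PartOf (genericProduct i' j') (termWord i' l' j') q) : i = i' ∧ j = j' := by
  classical
  have := (Nat.pos_of_ne_zero h.2).trans_le (h'.1 _)
  rw [coef_genericProduct] at this
  split_ifs at this with he
  · obtain ⟨l', he⟩ := he
    exact ⟨(termWord_inj he).1, (termWord_inj he).2.2⟩
  · simp at this

/-- A partial sum of an entry of the product contains a term only if it was obtained from a partial
sum containing it, or by computing the term. -/
theorem PartOf.of_mul_term {i l j : Fin N} {x y : FreeAlgebra ℕ (Entry N)}
    (h : PartOf (genericProduct i j) (termWord i l j) (x * y)) :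
    PartOf (genericProduct i j) (termWord i l j) x ∨
      PartOf (genericProduct i j) (termWord i l j) y ∨
        x = FreeAlgebra.ι ℕ (Entry.A i l) ∧ y = FreeAlgebra.ι ℕ (Entry.B l j) := by
  classical
  rcases h.of_mul with h' | h' | ⟨u, v, huv, hu1, hv1, hu, hv⟩
  · exact .inl h'
  · exact .inr (.inl h')
  refine .inr (.inr ?_)
  obtain ⟨rfl, rfl⟩ := of_mul_of_split hu1 hv1 huv
  -- All coefficients of the output entry are 0 or 1. So the two letters have coefficient 1 in the
  -- factors, and any further word in a factor would create a word foreign to the entry.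
  have hle : ∀ a b, coef x a * coef y b ≤ if ∃ l, a * b = termWord i l j then 1 else 0 :=
    fun a b => by
      rw [← coef_genericProduct]
      exact (coef_mul_le x y a b).trans (h.1 _)
  have h1 := hle (FreeMonoid.of (Entry.A i l)) (FreeMonoid.of (Entry.B l j))
  rw [if_pos ⟨l, rfl⟩] at h1
  have hx1 : coef x (FreeMonoid.of (Entry.A i l)) = 1 := by
    nlinarith [Nat.pos_of_ne_zero hu, Nat.pos_of_ne_zero hv]
  have hy1 : coef y (FreeMonoid.of (Entry.B l j)) = 1 := by
    nlinarith [Nat.pos_of_ne_zero hu, Nat.pos_of_ne_zero hv]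
  constructor
  · apply coef_ext
    intro w
    rw [coef_ι]
    split_ifs with hw
    · rw [hw, hx1]
    · have := hle w (FreeMonoid.of (Entry.B l j))
      rw [hy1, if_neg, mul_one] at this
      · exact Nat.le_zero.1 this
      -- The last letter `B[l,j]` forces `l' = l`, so the word in question could only be `A[i,l]`.
      · rintro ⟨l', e⟩
        have e' : FreeMonoid.toList w ++ [Entry.B l j] = [Entry.A i l'] ++ [Entry.B l' j] := e
        obtain ⟨e1, e2⟩ := List.append_inj' e' rfl
        simp at e2
        subst e2
        exact hw e1
  · apply coef_ext
    intro w
    rw [coef_ι]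
    split_ifs with hw
    · rw [hw, hy1]
    · have := hle (FreeMonoid.of (Entry.A i l)) w
      rw [hx1, if_neg, one_mul] at this
      · exact Nat.le_zero.1 this
      · rintro ⟨l', e⟩
        have e' : [Entry.A i l] ++ FreeMonoid.toList w = [Entry.A i l'] ++ [Entry.B l' j] := e
        obtain ⟨e1, e2⟩ := List.append_inj e' rfl
        simp at e1
        subst e1
        exact hw e2

/-! ### Tracing the origin of values -/

/-- Going back from the last operation, a value with property `P` is inherited from an operand until
the initial memory or a multiplication of type `E` is reached. It is stated abstractly to serve both
partial sums of outputs and, with `E` false, input entries. -/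
theorem exists_origin_in_code {Reg S : Type} [Semiring S] {P : S → Prop} {E : S → S → Prop}
    (h0 : ¬ P 0) (h1 : ¬ P 1) (hadd : ∀ x y, P (x + y) → P x ∨ P y)
    (hmul : ∀ x y, P (x * y) → P x ∨ P y ∨ E x y) (code : List (Instr Reg)) (mem : Reg → S)
    (d : Reg) (h : P (runCode code mem d)) :
    (∃ d, P (mem d)) ∨ ∃ c₁ c₂ d x y, code = c₁ ++ Instr.mul d x y :: c₂ ∧
      E (runCode c₁ mem x) (runCode c₁ mem y) := by
  classical
  induction code using List.reverseRecOn generalizing d with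
  | nil => exact .inl ⟨d, h⟩
  | append_singleton c a ih =>
    have ih' : ∀ d, P (runCode c mem d) → (∃ d, P (mem d)) ∨ ∃ c₁ c₂ d x y,
        c ++ [a] = c₁ ++ Instr.mul d x y :: c₂ ∧ E (runCode c₁ mem x) (runCode c₁ mem y) := by
      intro d hd
      rcases ih d hd with h | ⟨c₁, c₂, d, x, y, rfl, hE⟩
      · exact .inl h
      · exact .inr ⟨c₁, c₂ ++ [a], d, x, y, by simp, hE⟩
    rw [runCode_append, runCode_cons, runCode_nil] at h
    cases a with
    | zero e =>
      simp only [Instr.exec, Function.update_apply] at h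
      split_ifs at h
      · exact absurd h h0
      · exact ih' d h
    | one e =>
      simp only [Instr.exec, Function.update_apply] at h
      split_ifs at h
      · exact absurd h h1
      · exact ih' d h
    | add e x y =>
      simp only [Instr.exec, Function.update_apply] at h
      split_ifs at h
      · exact (hadd _ _ h).elim (ih' _) (ih' _)
      · exact ih' d h
    | mul e x y =>
      simp only [Instr.exec, Function.update_apply] at h
      split_ifs at h
      · rcases hmul _ _ h with h | h | h
        · exact ih' _ h
        · exact ih' _ h
        · exact .inr ⟨c, [], e, x, y, rfl, h⟩
      · exact ih' d h

theorem Step.card_src_le_degree {k : ℕ} {Reg : Type} (st : Step k Reg) (r : Fin (2 ^ k)) :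
    (st.msgs.filter fun μ => μ.src = r ∧ μ.dst ≠ r).card ≤ st.degree :=
  (le_max_left _ _).trans (Finset.le_sup (f := fun r => max
    (st.msgs.filter fun μ => μ.src = r ∧ μ.dst ≠ r).card
    (st.msgs.filter fun μ => μ.dst = r ∧ μ.src ≠ r).card) (Finset.mem_univ r))

theorem Step.card_dst_le_degree {k : ℕ} {Reg : Type} (st : Step k Reg) (r : Fin (2 ^ k)) :
    (st.msgs.filter fun μ => μ.dst = r ∧ μ.src ≠ r).card ≤ st.degree :=
  (le_max_right _ _).trans (Finset.le_sup (f := fun r => max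
    (st.msgs.filter fun μ => μ.src = r ∧ μ.dst ≠ r).card
    (st.msgs.filter fun μ => μ.dst = r ∧ μ.src ≠ r).card) (Finset.mem_univ r))

namespace Algorithm

variable {k N : ℕ}

/-- The memory before step `t`. -/
noncomputable def memAt (𝒜 : Algorithm k N) {S : Type} [Semiring S] (inst : Entry N → S) (t : ℕ) :
    Fin (2 ^ k) → 𝒜.Reg → S :=
  (𝒜.steps.take t).foldl Step.exec (𝒜.start inst)

/-- The value transported by a message of step `t`. -/
noncomputable def msgValue (𝒜 : Algorithm k N) {S : Type} [Semiring S] (inst : Entry N → S)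
    (x : (_ : Fin 𝒜.steps.length) × Message k 𝒜.Reg) : S :=
  runCode ((𝒜.steps.get x.1).code x.2.src) (𝒜.memAt inst x.1 x.2.src) x.2.srcReg

/-- The messages sent by PE `r` to other PEs. -/
def sent (𝒜 : Algorithm k N) (r : Fin (2 ^ k)) :
    Finset ((_ : Fin 𝒜.steps.length) × Message k 𝒜.Reg) :=
  Finset.univ.sigma fun t => (𝒜.steps.get t).msgs.filter fun μ => μ.src = r ∧ μ.dst ≠ r

/-- The messages that PE `r` receives from other PEs. -/
def received (𝒜 : Algorithm k N) (r : Fin (2 ^ k)) :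
    Finset ((_ : Fin 𝒜.steps.length) × Message k 𝒜.Reg) :=
  Finset.univ.sigma fun t => (𝒜.steps.get t).msgs.filter fun μ => μ.dst = r ∧ μ.src ≠ r

/-- The sum of the degrees of all steps. -/
def totalDegree (𝒜 : Algorithm k N) : ℕ := (𝒜.steps.map Step.degree).sum

theorem totalDegree_eq (𝒜 : Algorithm k N) :
    𝒜.totalDegree = ∑ t, (𝒜.steps.get t).degree := by
  rw [totalDegree, ← List.sum_ofFn]
  congr 1
  conv_lhs => rw [← List.ofFn_get 𝒜.steps, List.map_ofFn]
  rfl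

theorem card_sent_le (𝒜 : Algorithm k N) (r : Fin (2 ^ k)) : (𝒜.sent r).card ≤ 𝒜.totalDegree := by
  rw [sent, Finset.card_sigma, totalDegree_eq]
  exact Finset.sum_le_sum fun t _ => (𝒜.steps.get t).card_src_le_degree r

theorem card_received_le (𝒜 : Algorithm k N) (r : Fin (2 ^ k)) :
    (𝒜.received r).card ≤ 𝒜.totalDegree := by
  rw [received, Finset.card_sigma, totalDegree_eq]
  exact Finset.sum_le_sum fun t _ => (𝒜.steps.get t).card_dst_le_degree r

/-- A value with property `P` originates at PE `r`: it is initially there, or it is the product of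
two values with relation `E`. -/
def Origin (𝒜 : Algorithm k N) {S : Type} [Semiring S] (inst : Entry N → S) (P : S → Prop)
    (E : S → S → Prop) (r : Fin (2 ^ k)) : Prop :=
  (∃ d, P (𝒜.start inst r d)) ∨
    ∃ (t : Fin 𝒜.steps.length) (c₁ c₂ : List (Instr 𝒜.Reg)) (d x y : 𝒜.Reg),
      (𝒜.steps.get t).code r = c₁ ++ Instr.mul d x y :: c₂ ∧
        E (runCode c₁ (𝒜.memAt inst t r) x) (runCode c₁ (𝒜.memAt inst t r) y)

/-- Values with property `P` get from PE `r` to PE `r'`: the PEs are the same or one sends and the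
other receives such a value. -/
def Travels (𝒜 : Algorithm k N) {S : Type} [Semiring S] (inst : Entry N → S) (P : S → Prop)
    (r r' : Fin (2 ^ k)) : Prop :=
  r = r' ∨ (∃ x ∈ 𝒜.sent r, P (𝒜.msgValue inst x)) ∧ ∃ x ∈ 𝒜.received r', P (𝒜.msgValue inst x)

/-- Induction on time: a value was produced locally or received. Along a chain of messages only the
first sender and the last receiver are recorded, which is all that the counting needs. -/
theorem exists_origin (𝒜 : Algorithm k N) {S : Type} [Semiring S] (inst : Entry N → S)
    {P : S → Prop} {E : S → S → Prop}
    (h0 : ¬ P 0) (h1 : ¬ P 1) (hadd : ∀ x y, P (x + y) → P x ∨ P y)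
    (hmul : ∀ x y, P (x * y) → P x ∨ P y ∨ E x y) (t : ℕ) (ht : t ≤ 𝒜.steps.length)
    (r : Fin (2 ^ k)) (d : 𝒜.Reg) (h : P (𝒜.memAt inst t r d)) :
    ∃ r₀, 𝒜.Origin inst P E r₀ ∧ 𝒜.Travels inst P r₀ r := by
  induction t generalizing r d with
  | zero => exact ⟨r, .inl ⟨d, h⟩, .inl rfl⟩
  | succ t ih =>
    have loc : ∀ s d, P (runCode ((𝒜.steps.get ⟨t, ht⟩).code s) (𝒜.memAt inst t s) d) →
        ∃ r₀, 𝒜.Origin inst P E r₀ ∧ 𝒜.Travels inst P r₀ s := by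
      intro s d hs
      rcases exists_origin_in_code h0 h1 hadd hmul _ _ _ hs with ⟨d, hd⟩ | ⟨c₁, c₂, d, x, y, hc, hE⟩
      · exact ih (by omega) s d hd
      · exact ⟨s, .inr ⟨⟨t, ht⟩, c₁, c₂, d, x, y, hc, hE⟩, .inl rfl⟩
    have e : 𝒜.memAt inst (t + 1) = Step.exec (𝒜.memAt inst t) (𝒜.steps.get ⟨t, ht⟩) := by
      rw [memAt, List.take_succ_eq_append_getElem ht, List.foldl_append]
      rfl
    rw [e] at h
    rcases Step.exec_cases (𝒜.memAt inst t) (𝒜.steps.get ⟨t, ht⟩) r d with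
      ⟨μ, hμ, rfl, rfl, hv⟩ | hv
    · rw [hv] at h
      obtain ⟨r₀, hr, ht'⟩ := loc _ _ h
      by_cases hne : μ.src = μ.dst
      · exact ⟨r₀, hr, hne ▸ ht'⟩
      have hx : ∃ x ∈ 𝒜.received μ.dst, P (𝒜.msgValue inst x) :=
        ⟨⟨⟨t, ht⟩, μ⟩, by simpa [received, hne] using hμ, h⟩
      -- If the value originated at the sender, this message is also the sent one; otherwise the
      -- origin has already sent one before, and only the received message is replaced.
      rcases ht' with rfl | ⟨hs, -⟩
      · exact ⟨μ.src, hr, .inr ⟨⟨⟨⟨t, ht⟩, μ⟩, by simpa [sent, Ne.symm hne] using hμ, h⟩, hx⟩⟩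
      · exact ⟨r₀, hr, .inr ⟨hs, hx⟩⟩
    · rw [hv] at h
      exact loc _ _ h

theorem memAt_length (𝒜 : Algorithm k N) {S : Type} [Semiring S] (inst : Entry N → S) :
    𝒜.memAt inst 𝒜.steps.length = 𝒜.final inst := by
  rw [memAt, List.take_length, final]

/-- Every multiplicative term is computed by a PE that is responsible for the corresponding
output entry, or sends a partial sum of that entry. -/
theorem Solves.exists_computes {𝒜 : Algorithm k N} (h : 𝒜.Solves) (i l j : Fin N) :
    ∃ r, 𝒜.Computes r (i, l, j) ∧ 𝒜.Travels (FreeAlgebra.ι ℕ)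
      (PartOf (genericProduct i j) (termWord i l j)) r (𝒜.output i j).1 := by
  -- Correctness is applied to generic matrices.
  have hS := h (FreeAlgebra ℕ (Entry N)) (fun i j => FreeAlgebra.ι ℕ (Entry.A i j))
    (fun i j => FreeAlgebra.ι ℕ (Entry.B i j)) i j
  rw [show Entry.val (fun i j => FreeAlgebra.ι ℕ (Entry.A i j))
    (fun i j => FreeAlgebra.ι ℕ (Entry.B i j)) = FreeAlgebra.ι ℕ (X := Entry N) from
    funext fun e => by cases e <;> rfl] at hS
  obtain ⟨r, hr, ht⟩ := 𝒜.exists_origin (FreeAlgebra.ι ℕ)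
    (P := PartOf (genericProduct i j) (termWord i l j))
    (E := fun x y => x = FreeAlgebra.ι ℕ (Entry.A i l) ∧ y = FreeAlgebra.ι ℕ (Entry.B l j))
    not_partOf_zero (not_partOf_one (termWord_ne_one i l j)) (fun _ _ => PartOf.of_add)
    (fun _ _ => PartOf.of_mul_term) 𝒜.steps.length le_rfl (𝒜.output i j).1 (𝒜.output i j).2
    (by rw [memAt_length, hS]; exact partOf_genericProduct i l j)
  refine ⟨r, ?_, ht⟩
  rcases hr with ⟨d, hd⟩ | ⟨t, c₁, c₂, d, x, y, hc, hx, hy⟩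
  -- Initial values are 0 or single letters and do not contain a word of length two.
  · exfalso
    simp only [start] at hd
    cases hin : 𝒜.input r d with
    | none => rw [hin] at hd; exact not_partOf_zero hd
    | some e =>
      rw [hin] at hd
      refine hd.2 ?_
      simp only [Option.elim_some]
      rw [coef_ι, if_neg]
      intro he
      have : [Entry.A i l, Entry.B l j] = [e] := he
      simp at this
  · refine ⟨𝒜.steps.take t, 𝒜.steps.drop (t + 1), 𝒜.steps.get t, c₁, c₂, d, x, y, ?_, hc, hx, hy⟩
    rw [List.get_eq_getElem, ← List.drop_eq_getElem_cons, List.take_append_drop]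

/-- A PE that computes with the value of an input entry held that entry initially or
received its value. -/
theorem exists_input (𝒜 : Algorithm k N) (e : Entry N) {before after : List (Step k 𝒜.Reg)}
    {st : Step k 𝒜.Reg} (hs : 𝒜.steps = before ++ st :: after) {r : Fin (2 ^ k)}
    {c : List (Instr 𝒜.Reg)} {x : 𝒜.Reg}
    (h : runCode c (before.foldl Step.exec (𝒜.start (FreeAlgebra.ι ℕ)) r) x =
      FreeAlgebra.ι ℕ e) :
    (∃ d, 𝒜.input r d = some e) ∨ ∃ x ∈ 𝒜.received r,
      PartOf (FreeAlgebra.ι ℕ e) (FreeMonoid.of e) (𝒜.msgValue (FreeAlgebra.ι ℕ) x) := by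
  have h0 : ¬ PartOf (FreeAlgebra.ι ℕ e) (FreeMonoid.of e) 0 := not_partOf_zero
  have h1 : ¬ PartOf (FreeAlgebra.ι ℕ e) (FreeMonoid.of e) 1 :=
    not_partOf_one (FreeMonoid.of_ne_one e)
  have hmul : ∀ x y, PartOf (FreeAlgebra.ι ℕ e) (FreeMonoid.of e) (x * y) →
      PartOf (FreeAlgebra.ι ℕ e) (FreeMonoid.of e) x ∨
        PartOf (FreeAlgebra.ι ℕ e) (FreeMonoid.of e) y ∨ False :=
    fun x y hxy => hxy.of_mul_ι.imp_right .inl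
  obtain ⟨d, hd⟩ : ∃ d, PartOf (FreeAlgebra.ι ℕ e) (FreeMonoid.of e)
      (before.foldl Step.exec (𝒜.start (FreeAlgebra.ι ℕ)) r d) := by
    rcases exists_origin_in_code (E := fun _ _ => False) h0 h1 (fun _ _ => PartOf.of_add) hmul c _ x
      (by rw [h]; exact partOf_ι e) with h | ⟨_, _, _, _, _, _, h⟩
    · exact h
    · exact h.elim
  have hb : 𝒜.memAt (FreeAlgebra.ι ℕ) before.length =
      before.foldl Step.exec (𝒜.start (FreeAlgebra.ι ℕ)) := by
    rw [memAt, hs, List.take_left]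
  rw [← hb] at hd
  obtain ⟨r₀, hr, ht⟩ := 𝒜.exists_origin (FreeAlgebra.ι ℕ) (E := fun _ _ => False) h0 h1
    (fun _ _ => PartOf.of_add) hmul before.length (by rw [hs]; simp) r d hd
  rcases hr with ⟨d', hd'⟩ | ⟨_, _, _, _, _, _, _, h⟩
  · rcases ht with rfl | ⟨-, ht⟩
    · left
      simp only [start] at hd'
      refine ⟨d', ?_⟩
      cases hin : 𝒜.input r₀ d' with
      | none => rw [hin] at hd'; exact absurd hd' not_partOf_zero
      | some e' =>
        rw [hin] at hd'
        rw [hd'.ι_congr (partOf_ι e')]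
    · exact .inr ht
  · exact h.elim

theorem Computes.exists_input {𝒜 : Algorithm k N} {r : Fin (2 ^ k)} {i l j : Fin N}
    (h : 𝒜.Computes r (i, l, j)) (e : Entry N) (he : e = .A i l ∨ e = .B l j) :
    (∃ d, 𝒜.input r d = some e) ∨ ∃ x ∈ 𝒜.received r,
      PartOf (FreeAlgebra.ι ℕ e) (FreeMonoid.of e) (𝒜.msgValue (FreeAlgebra.ι ℕ) x) := by
  obtain ⟨before, after, st, c₁, c₂, d, x, y, hs, -, hx, hy⟩ := h
  rcases he with rfl | rfl
  · exact 𝒜.exists_input _ hs hx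
  · exact 𝒜.exists_input _ hs hy

/-! ### The lower bound on the communication -/

/-- The discrete Loomis-Whitney inequality in dimension three. -/
theorem card_sq_le_card_mul_card_mul_card {α β γ : Type} [DecidableEq α] [DecidableEq β]
    [DecidableEq γ] (T : Finset (α × β × γ)) :
    T.card ^ 2 ≤ (T.image fun t => (t.1, t.2.1)).card * (T.image fun t => (t.2.1, t.2.2)).card *
      (T.image fun t => (t.1, t.2.2)).card := by
  set C := T.image fun t => (t.1, t.2.2) with hC
  have h1 : T.card = ∑ c ∈ C, (T.filter fun t => (t.1, t.2.2) = c).card :=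
    Finset.card_eq_sum_card_fiberwise fun t ht => Finset.mem_image_of_mem _ ht
  -- The sum counts pairs `(s, t)` of triples with equal outer coordinates. The first two
  -- coordinates of `s` and the last two of `t` determine such a pair. Cauchy-Schwarz over the
  -- fibres then concludes.
  have h2 : ∑ c ∈ C, (T.filter fun t => (t.1, t.2.2) = c).card ^ 2 ≤
      (T.image fun t => (t.1, t.2.1)).card * (T.image fun t => (t.2.1, t.2.2)).card := by
    have e : ∑ c ∈ C, (T.filter fun t => (t.1, t.2.2) = c).card ^ 2 =
        (C.sigma fun c => (T.filter fun t => (t.1, t.2.2) = c) ×ˢ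
          (T.filter fun t => (t.1, t.2.2) = c)).card := by
      rw [Finset.card_sigma]
      exact Finset.sum_congr rfl fun c _ => by rw [Finset.card_product, sq]
    rw [e, ← Finset.card_product]
    apply Finset.card_le_card_of_injOn
      (fun x => ((x.2.1.1, x.2.1.2.1), (x.2.2.2.1, x.2.2.2.2)))
    · rintro ⟨c, s, t⟩ h
      simp only [Finset.coe_sigma, Set.mem_sigma_iff, Finset.mem_coe, Finset.mem_product,
        Finset.mem_filter] at h
      simp only [Finset.coe_product, Set.mem_prod, Finset.mem_coe]
      exact ⟨Finset.mem_image_of_mem (fun t : α × β × γ => (t.1, t.2.1)) h.2.1.1,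
        Finset.mem_image_of_mem (fun t : α × β × γ => (t.2.1, t.2.2)) h.2.2.1⟩
    · rintro ⟨c, s, t⟩ h ⟨c', s', t'⟩ h' hst
      simp only [Finset.coe_sigma, Set.mem_sigma_iff, Finset.mem_coe, Finset.mem_product,
        Finset.mem_filter] at h h'
      obtain ⟨-, ⟨-, rfl⟩, -, ht⟩ := h
      obtain ⟨-, ⟨-, rfl⟩, -, ht'⟩ := h'
      obtain ⟨s1, s2, s3⟩ := s
      obtain ⟨t1, t2, t3⟩ := t
      obtain ⟨u1, u2, u3⟩ := s'
      obtain ⟨v1, v2, v3⟩ := t'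
      simp only [Prod.mk.injEq] at hst ht ht'
      obtain ⟨⟨rfl, rfl⟩, rfl, rfl⟩ := hst
      obtain ⟨rfl, rfl⟩ := ht
      obtain ⟨rfl, rfl⟩ := ht'
      rfl
  calc T.card ^ 2 ≤ C.card * ∑ c ∈ C, (T.filter fun t => (t.1, t.2.2) = c).card ^ 2 := by
        rw [h1]; exact sq_sum_le_card_mul_sum_sq
    _ ≤ _ := by rw [mul_comm]; exact Nat.mul_le_mul_right _ h2

/-- Up to the factor 27, the difference is half of `(x + y + z) * ((x - y) ^ 2 + (y - z) ^ 2 + (z -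
x) ^ 2)` plus three times `x * (y - z) ^ 2 + y * (x - z) ^ 2 + z * (x - y) ^ 2`. -/
theorem mul_mul_le_mean_cube {x y z : ℝ} (hx : 0 ≤ x) (hy : 0 ≤ y) (hz : 0 ≤ z) :
    x * y * z ≤ ((x + y + z) / 3) ^ 3 := by
  nlinarith [mul_nonneg hx (sq_nonneg (y - z)), mul_nonneg hy (sq_nonneg (x - z)),
    mul_nonneg hz (sq_nonneg (x - y)), mul_nonneg hx (sq_nonneg (x - z)),
    mul_nonneg hx (sq_nonneg (x - y)), mul_nonneg hy (sq_nonneg (y - z)),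
    mul_nonneg hy (sq_nonneg (y - x)), mul_nonneg hz (sq_nonneg (z - y)),
    mul_nonneg hz (sq_nonneg (z - x))]

/-- If shares `t` of the work are bounded by the volumes attainable with shares `s` of the data and
a surplus `h`, and no share exceeds `1 / 2`, then the surplus is large. -/
theorem surplus_bound {ι : Type} [Fintype ι] (hι : 0 < Fintype.card ι) (s t : ι → ℝ) (h : ℝ)
    (hh : 0 ≤ h)
    (hs : ∀ r, 0 ≤ s r) (ht2 : ∀ r, t r ≤ 1 / 2)
    (hst : ∀ r, t r ^ 2 ≤ (s r + h) ^ 3) (hs1 : ∑ r, s r ≤ 1) (ht1 : 1 ≤ ∑ r, t r) :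
    (1 / 50) ^ 3 ≤ h ^ 3 * (Fintype.card ι : ℝ) ^ 2 := by
  by_contra! hlt
  set p : ℝ := (Fintype.card ι : ℝ) with hp
  have hp0 : 0 < p := by rw [hp]; exact_mod_cast hι
  -- Summed over all `r`, this gives a total share of at most `0.91 + 0.08 < 1`, a contradiction.
  have key : ∀ r, t r ≤ 91 / 100 * s r + 8 / 100 / p := by
    intro r
    rcases le_total (7 * h) (s r) with hr | hr
    · have h1 : (s r + h) ^ 3 ≤ (8 / 7 * s r) ^ 3 :=
        pow_le_pow_left₀ (add_nonneg (hs r) hh) (by linarith) 3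
      -- The surplus is negligible here. The bound `1 / 2` on the share gains a factor: `(8 / 7) ^ 3
      -- / 2 < 0.91 ^ 3`.
      have h2 : t r ^ 3 ≤ (91 / 100 * s r) ^ 3 := by
        have h3 : t r ^ 3 ≤ 1 / 2 * t r ^ 2 := by
          rw [pow_succ' (t r) 2]
          exact mul_le_mul_of_nonneg_right (ht2 r) (sq_nonneg _)
        have h4 := hst r
        have h5 : 0 ≤ s r ^ 3 := pow_nonneg (hs r) 3
        nlinarith
      have h6 := le_of_pow_le_pow_left₀ (by norm_num) (mul_nonneg (by norm_num) (hs r)) h2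
      have h7 : 0 ≤ 8 / 100 / p := by positivity
      linarith
    · have h1 : (s r + h) ^ 3 ≤ (8 * h) ^ 3 :=
        pow_le_pow_left₀ (add_nonneg (hs r) hh) (by linarith) 3
      -- The surplus dominates here; `8 ^ 3 / 50 ^ 3 < 0.08 ^ 2`.
      have h2 : t r ^ 2 ≤ (8 / 100 / p) ^ 2 := by
        rw [div_pow, le_div_iff₀ (by positivity)]
        have := hst r
        nlinarith [mul_le_mul_of_nonneg_right ((hst r).trans h1) (sq_nonneg p)]
      have h3 := le_of_sq_le_sq h2 (by positivity)
      linarith [hs r]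
  have hsum : ∑ r, t r ≤ 91 / 100 * ∑ r, s r + 8 / 100 := by
    refine (Finset.sum_le_sum fun r _ => key r).trans ?_
    rw [Finset.sum_add_distrib, ← Finset.mul_sum, Finset.sum_const, Finset.card_univ,
      nsmul_eq_mul, ← hp, mul_div_cancel₀ _ hp0.ne']
  linarith

theorem sum_card_filter_le {ι α : Type} [Fintype ι] [Fintype α] [DecidableEq α] (R : ι → α → Prop)
    [∀ r, DecidablePred (R r)] (h : ∀ a r r', R r a → R r' a → r = r') :
    ∑ r, (Finset.univ.filter (R r)).card ≤ Fintype.card α := by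
  classical
  rw [← Finset.card_biUnion]
  · exact Finset.card_le_univ _
  · intro r _ r' _ hne
    rw [Function.onFun, Finset.disjoint_left]
    intro a ha ha'
    exact hne (h a r r' (Finset.mem_filter.1 ha).2 (Finset.mem_filter.1 ha').2)

/-- The counting scheme for projections: an entry is either owned or paid for by a message, and a
message pays for only one entry. -/
theorem card_le_card_add_card {α β : Type} [DecidableEq α] {s u : Finset α} {t : Finset β}
    (R : α → β → Prop) (h : ∀ a ∈ s, a ∈ u ∨ ∃ b, b ∈ t ∧ R a b)
    (hR : ∀ a a' b, R a b → R a' b → a = a') : s.card ≤ u.card + t.card := by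
  have h1 : (s \ u).card ≤ t.card := by
    refine Finset.card_le_card_of_forall_subsingleton R (fun a ha => ?_)
      (fun b _ a ha a' ha' => hR a a' b ha.2 ha'.2)
    rw [Finset.mem_sdiff] at ha
    exact (h a ha.1).resolve_left ha.2
  have h2 := Finset.card_le_card_sdiff_add_card (s := s) (t := u)
  omega

/-- The number of messages that have to be exchanged by an algorithm in which no PE computes more
than half of the multiplicative terms. -/
theorem totalDegree_bound {𝒜 : Algorithm k N} (hN : 0 < N) (h1 : 𝒜.Solves) (h2 : 𝒜.NoReplication)
    (h3 : ∀ r, ({t | 𝒜.Computes r t}.ncard : ℝ) ≤ (N : ℝ) ^ 3 / 2) :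
    (1 / 50) ^ 3 ≤ ((𝒜.totalDegree : ℝ) / (N : ℝ) ^ 2) ^ 3 * ((2 : ℝ) ^ k) ^ 2 := by
  classical
  -- Terms may be computed repeatedly. Fixing one suitable PE per term makes the sets `T r` a
  -- partition of all terms.
  choose f hf hf' using fun t : Fin N × Fin N × Fin N => h1.exists_computes t.1 t.2.1 t.2.2
  set T : Fin (2 ^ k) → Finset (Fin N × Fin N × Fin N) := fun r =>
    Finset.univ.filter fun t => f t = r with hT
  set α : Fin (2 ^ k) → Finset (Fin N × Fin N) := fun r =>
    Finset.univ.filter fun w => ∃ d, 𝒜.input r d = some (.A w.1 w.2)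
  set β : Fin (2 ^ k) → Finset (Fin N × Fin N) := fun r =>
    Finset.univ.filter fun w => ∃ d, 𝒜.input r d = some (.B w.1 w.2)
  set γ : Fin (2 ^ k) → Finset (Fin N × Fin N) := fun r =>
    Finset.univ.filter fun w => (𝒜.output w.1 w.2).1 = r
  have cA : ∀ r, ((T r).image fun t => (t.1, t.2.1)).card ≤ (α r).card + 𝒜.totalDegree := by
    intro r
    refine (card_le_card_add_card (t := 𝒜.received r) (fun w x =>
      PartOf (FreeAlgebra.ι ℕ (Entry.A w.1 w.2)) (FreeMonoid.of (Entry.A w.1 w.2))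
        (𝒜.msgValue (FreeAlgebra.ι ℕ) x)) ?_ ?_).trans
      (Nat.add_le_add_left (𝒜.card_received_le r) _)
    · intro w hw
      obtain ⟨t, ht, rfl⟩ := Finset.mem_image.1 hw
      have hr : f t = r := (Finset.mem_filter.1 ht).2
      have hc : 𝒜.Computes r (t.1, t.2.1, t.2.2) := hr ▸ hf t
      simpa [α] using hc.exists_input _ (.inl rfl)
    · rintro ⟨a, b⟩ ⟨a', b'⟩ x h h'
      have := h.ι_congr h'
      simpa using this
  have cB : ∀ r, ((T r).image fun t => (t.2.1, t.2.2)).card ≤ (β r).card + 𝒜.totalDegree := by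
    intro r
    refine (card_le_card_add_card (t := 𝒜.received r) (fun w x =>
      PartOf (FreeAlgebra.ι ℕ (Entry.B w.1 w.2)) (FreeMonoid.of (Entry.B w.1 w.2))
        (𝒜.msgValue (FreeAlgebra.ι ℕ) x)) ?_ ?_).trans
      (Nat.add_le_add_left (𝒜.card_received_le r) _)
    · intro w hw
      obtain ⟨t, ht, rfl⟩ := Finset.mem_image.1 hw
      have hr : f t = r := (Finset.mem_filter.1 ht).2
      have hc : 𝒜.Computes r (t.1, t.2.1, t.2.2) := hr ▸ hf t
      simpa [β] using hc.exists_input _ (.inr rfl)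
    · rintro ⟨a, b⟩ ⟨a', b'⟩ x h h'
      have := h.ι_congr h'
      simpa using this
  have cC : ∀ r, ((T r).image fun t => (t.1, t.2.2)).card ≤ (γ r).card + 𝒜.totalDegree := by
    intro r
    refine (card_le_card_add_card (t := 𝒜.sent r) (fun w x =>
      ∃ l, PartOf (genericProduct w.1 w.2) (termWord w.1 l w.2)
        (𝒜.msgValue (FreeAlgebra.ι ℕ) x)) ?_ ?_).trans
      (Nat.add_le_add_left (𝒜.card_sent_le r) _)
    · intro w hw
      obtain ⟨t, ht, rfl⟩ := Finset.mem_image.1 hw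
      have hr : f t = r := (Finset.mem_filter.1 ht).2
      rcases hf' t with h | ⟨⟨x, hx, hP⟩, -⟩
      · left
        simp [γ, ← h, hr]
      · exact .inr ⟨x, hr ▸ hx, t.2.1, hP⟩
    · rintro ⟨a, b⟩ ⟨a', b'⟩ x ⟨l, h⟩ ⟨l', h'⟩
      have := PartOf.genericProduct_congr h h'
      simpa using this
  have sA : ∑ r, (α r).card ≤ N ^ 2 := by
    refine (sum_card_filter_le _ ?_).trans (by simp [sq])
    rintro a r r' ⟨d, h⟩ ⟨d', h'⟩
    exact (h2 _ r r' d d' h h').1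
  have sB : ∑ r, (β r).card ≤ N ^ 2 := by
    refine (sum_card_filter_le _ ?_).trans (by simp [sq])
    rintro a r r' ⟨d, h⟩ ⟨d', h'⟩
    exact (h2 _ r r' d d' h h').1
  have sC : ∑ r, (γ r).card ≤ N ^ 2 := by
    refine (sum_card_filter_le _ ?_).trans (by simp [sq])
    exact fun a r r' h h' => h.symm.trans h'
  have sT : ∑ r, (T r).card = N ^ 3 := by
    rw [hT, ← Finset.card_eq_sum_card_fiberwise (fun _ _ => Finset.mem_univ _)]
    simp
    ring
  have hN0 : (0 : ℝ) < N := by exact_mod_cast hN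
  have hM : (0 : ℝ) ≤ (𝒜.totalDegree : ℝ) / (N : ℝ) ^ 2 := by positivity
  have := surplus_bound (ι := Fin (2 ^ k)) (by simp)
    (fun r => (((α r).card : ℝ) + (β r).card + (γ r).card) / (3 * (N : ℝ) ^ 2))
    (fun r => ((T r).card : ℝ) / (N : ℝ) ^ 3) ((𝒜.totalDegree : ℝ) / (N : ℝ) ^ 2) hM
    (fun r => by positivity) ?_ ?_ ?_ ?_
  · simpa using this
  · intro r
    rw [div_le_iff₀ (by positivity)]
    have : (T r).card ≤ {t | 𝒜.Computes r t}.ncard := by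
      rw [← Set.ncard_coe_finset]
      refine Set.ncard_le_ncard ?_ (Set.toFinite _)
      intro t ht
      have hr : f t = r := (Finset.mem_filter.1 (Finset.mem_coe.1 ht)).2
      exact hr ▸ hf t
    have h4 : ((T r).card : ℝ) ≤ ({t | 𝒜.Computes r t}.ncard : ℝ) := by exact_mod_cast this
    have := h3 r
    linarith
  · intro r
    have lw := card_sq_le_card_mul_card_mul_card (T r)
    have lw' : (T r).card ^ 2 ≤ ((α r).card + 𝒜.totalDegree) * ((β r).card + 𝒜.totalDegree) *
        ((γ r).card + 𝒜.totalDegree) :=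
      lw.trans (Nat.mul_le_mul (Nat.mul_le_mul (cA r) (cB r)) (cC r))
    have lw'' : ((T r).card : ℝ) ^ 2 ≤ ((α r).card + 𝒜.totalDegree) *
        ((β r).card + 𝒜.totalDegree) * ((γ r).card + 𝒜.totalDegree) := by exact_mod_cast lw'
    have am := lw''.trans (mul_mul_le_mean_cube (by positivity) (by positivity) (by positivity))
    have e1 : (((T r).card : ℝ) / (N : ℝ) ^ 3) ^ 2 = ((T r).card : ℝ) ^ 2 / ((N : ℝ) ^ 2) ^ 3 := by
      rw [div_pow]; ring
    have e2 : ((((α r).card : ℝ) + (β r).card + (γ r).card) / (3 * (N : ℝ) ^ 2) +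
        (𝒜.totalDegree : ℝ) / (N : ℝ) ^ 2) =
        (((α r).card + 𝒜.totalDegree + ((β r).card + 𝒜.totalDegree) +
          ((γ r).card + 𝒜.totalDegree)) / 3 : ℝ) / (N : ℝ) ^ 2 := by
      field_simp
      ring
    simp only [e1, e2]
    rw [div_pow (_ / 3)]
    exact div_le_div_of_nonneg_right am (by positivity)
  · rw [← Finset.sum_div, div_le_one (by positivity), Finset.sum_add_distrib,
      Finset.sum_add_distrib]
    have a : (∑ r, ((α r).card : ℝ)) ≤ (N : ℝ) ^ 2 := by exact_mod_cast sA
    have b : (∑ r, ((β r).card : ℝ)) ≤ (N : ℝ) ^ 2 := by exact_mod_cast sB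
    have c : (∑ r, ((γ r).card : ℝ)) ≤ (N : ℝ) ^ 2 := by exact_mod_cast sC
    linarith
  · rw [← Finset.sum_div, le_div_iff₀ (by positivity), one_mul]
    have : (∑ r, ((T r).card : ℝ)) = (N : ℝ) ^ 3 := by exact_mod_cast sT
    exact this.ge

/-! ### From the sum of the degrees to the communication complexity -/

theorem sum_range_filter_label {Reg : Type} {M : Type} [AddCommMonoid M] (l : List (Step k Reg))
    (f : Step k Reg → M) (n : ℕ) :
    ∑ i ∈ Finset.range n, ((l.filter fun st => st.label = i).map f).sum =
      ((l.filter fun st => st.label < n).map f).sum := by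
  induction l with
  | nil => simp
  | cons st l ih =>
    have : ∀ i, (((st :: l).filter fun st => st.label = i).map f).sum =
        (if st.label = i then f st else 0) + ((l.filter fun st => st.label = i).map f).sum := by
      intro i
      rw [List.filter_cons]
      split_ifs <;> simp_all
    rw [Finset.sum_congr rfl fun i _ => this i, Finset.sum_add_distrib, ih, List.filter_cons]
    simp only [Finset.sum_ite_eq, Finset.mem_range, decide_eq_true_eq]
    split_ifs <;> simp

theorem commComplexity_eq (𝒜 : Algorithm k N) (σ : ℝ) :
    𝒜.commComplexity σ =
      ((𝒜.steps.filter fun st => st.label < k).map fun st => (st.degree : ℝ) + σ).sum := by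
  rw [← sum_range_filter_label, commComplexity]
  refine Finset.sum_congr rfl fun i _ => ?_
  rw [cumDegree, numSupersteps]
  induction 𝒜.steps.filter fun st => st.label = i with
  | nil => simp
  | cons st l ih =>
    simp only [List.map_cons, List.sum_cons, List.length_cons, ← ih]
    push_cast
    ring

theorem degree_eq_zero {Reg : Type} (st : Step k Reg) (h : k ≤ st.label) : st.degree = 0 := by
  have hc : ∀ μ ∈ st.msgs, μ.src = μ.dst := by
    intro μ hμ
    have := st.cluster μ hμ
    rw [Nat.sub_eq_zero_of_le h, pow_zero, Nat.div_one, Nat.div_one] at this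
    exact Fin.ext this
  rw [Step.degree, ← Nat.le_zero]
  refine Finset.sup_le fun r _ => ?_
  rw [max_le_iff, Nat.le_zero, Nat.le_zero, Finset.card_eq_zero, Finset.card_eq_zero,
    Finset.filter_eq_empty_iff, Finset.filter_eq_empty_iff]
  exact ⟨fun μ hμ h' => h'.2 ((hc μ hμ).symm.trans h'.1),
    fun μ hμ h' => h'.2 ((hc μ hμ).trans h'.1)⟩

/-- Steps that are not supersteps enter only the left side, but their messages never leave a PE and
their degree is 0. -/
theorem totalDegree_le_commComplexity (𝒜 : Algorithm k N) {σ : ℝ} (hσ : 0 ≤ σ) :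
    (𝒜.totalDegree : ℝ) ≤ 𝒜.commComplexity σ := by
  rw [commComplexity_eq, totalDegree]
  induction 𝒜.steps with
  | nil => simp
  | cons st l ih =>
    rw [List.filter_cons, List.map_cons, List.sum_cons]
    split_ifs with h
    · rw [List.map_cons, List.sum_cons, Nat.cast_add]
      linarith
    · rw [degree_eq_zero st (by simpa using h), zero_add]
      exact ih

/-- The communication complexity of the algorithms of the class is `Ω(n / p ^ (2/3))`. -/
theorem InClass.commComplexity_ge {𝒜 : Algorithm k N} (h : 𝒜.InClass) (hN : 0 < N) (hk : 1 ≤ k)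
    {σ : ℝ} (hσ : 0 ≤ σ) :
    1 / 50 * ((N : ℝ) ^ 2 / ((2 : ℝ) ^ k) ^ (2 / 3 : ℝ)) ≤ 𝒜.commComplexity σ := by
  obtain ⟨⟨h1, h2, h3⟩, -⟩ := h
  have hN0 : (0 : ℝ) < N := by exact_mod_cast hN
  have hb := totalDegree_bound hN h1 h2 fun r => by
    refine (h3 r).trans (div_le_div_of_nonneg_left (by positivity) (by norm_num) ?_)
    -- Of the balance condition only `min {p, 11 ^ 3} ≥ 2` is used.
    refine le_min ?_ (by norm_num)
    calc (2 : ℝ) = 2 ^ 1 := (pow_one _).symm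
      _ ≤ 2 ^ k := pow_le_pow_right₀ (by norm_num) hk
  refine le_trans ?_ (𝒜.totalDegree_le_commComplexity hσ)
  set p : ℝ := 2 ^ k with hp
  have hp0 : 0 < p := by positivity
  have e : (p ^ (2 / 3 : ℝ)) ^ 3 = p ^ 2 := by
    rw [← Real.rpow_natCast, ← Real.rpow_mul hp0.le, ← Real.rpow_natCast]
    norm_num
  rw [← e, ← mul_pow] at hb
  have h4 := le_of_pow_le_pow_left₀ (by norm_num) (by positivity) hb
  have hq : 0 < p ^ (2 / 3 : ℝ) := Real.rpow_pos_of_pos hp0 _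
  rw [← mul_div_assoc, div_le_iff₀ hq]
  rw [div_mul_eq_mul_div, le_div_iff₀ (by positivity)] at h4
  exact h4

end Algorithm

/-! ### Correctness of the recursive algorithm -/

/-- The register that receives the result of an operation. -/
def Instr.target {Reg : Type} : Instr Reg → Reg
  | .zero d => d
  | .one d => d
  | .add d _ _ => d
  | .mul d _ _ => d

theorem runCode_of_target_ne {Reg S : Type} [Semiring S] {code : List (Instr Reg)} {e : Reg}
    (h : ∀ a ∈ code, a.target ≠ e) (mem : Reg → S) : runCode code mem e = mem e := by
  classical
  induction code generalizing mem with
  | nil => rfl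
  | cons a c ih =>
    rw [runCode_cons, ih fun b hb => h b (List.mem_cons_of_mem _ hb)]
    have := h a List.mem_cons_self
    cases a <;> exact Function.update_of_ne (Ne.symm this) _ _

theorem foldl_finRange_induction {α : Type} (P : ℕ → α → Prop) {n : ℕ} (f : α → Fin n → α) {x : α}
    (h0 : P 0 x) (hs : ∀ (i : Fin n) x, P i x → P (i + 1) (f x i)) :
    P n ((List.finRange n).foldl f x) := by
  induction n generalizing P x with
  | zero => simpa using h0
  | succ n ih =>
    rw [List.finRange_succ, List.foldl_cons, List.foldl_map]
    exact ih (fun i => P (i + 1)) (fun x i => f x i.succ) (hs 0 x h0) fun i x hx => hs i.succ x hx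

theorem foldl_finRange_reverse_induction {α : Type} (P : ℕ → α → Prop) {n : ℕ} (f : α → Fin n → α)
    {x : α} (h0 : P n x) (hs : ∀ (i : Fin n) x, P (i + 1) x → P i (f x i)) :
    P 0 ((List.finRange n).reverse.foldl f x) := by
  induction n generalizing P x with
  | zero => simpa using h0
  | succ n ih =>
    rw [List.finRange_succ, List.reverse_cons, List.foldl_append, List.foldl_cons, List.foldl_nil,
      ← List.map_reverse, List.foldl_map]
    exact hs 0 _ (ih (fun i => P (i + 1)) (fun x i => f x i.succ) h0 fun i x hx => hs i.succ x hx)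

namespace MM

variable {m : ℕ} {S : Type} [Semiring S]

theorem levels_pos (hm : 1 ≤ m) : 0 < levels m := by unfold levels; omega

theorem levels_le (hm : 1 ≤ m) : levels m ≤ m := by unfold levels; omega

/-- The value assigned by `entryCode` to its entry. -/
def entryVal (i z : ℕ) (a b : Fin (2 ^ m)) (mem : Reg m → S) : S :=
  if i = levels m then
    ∑ c : Fin (2 ^ m) with blk i c = z, mem (.A i (blk i b) a c) * mem (.B i (blk i a) c b)
  else mem (.C (i + 1) (2 * z) a b) + mem (.C (i + 1) (2 * z + 1) a b)

/-- The computation of an entry of level `i` reads no register that the computations of other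
entries of level `i` write to, so their order is irrelevant. -/
theorem entryVal_congr {i z : ℕ} {a b : Fin (2 ^ m)} {mem mem' : Reg m → S}
    (h : ∀ e, (∀ z a b, e ≠ .C i z a b) → e ≠ .tmp → mem e = mem' e) :
    entryVal i z a b mem = entryVal i z a b mem' := by
  unfold entryVal
  split_ifs
  · refine Finset.sum_congr rfl fun c _ => ?_
    rw [h _ (by simp) (by simp), h _ (by simp) (by simp)]
  · rw [h _ (by simp) (by simp), h _ (by simp) (by simp)]

theorem target_of_mem_entryCode {i z : ℕ} {a b : Fin (2 ^ m)} {x : Instr (Reg m)}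
    (h : x ∈ entryCode i z a b) : x.target = .C i z a b ∨ x.target = .tmp := by
  unfold entryCode at h
  split_ifs at h
  · simp only [List.mem_cons, List.mem_flatMap, List.not_mem_nil, or_false] at h
    rcases h with rfl | ⟨c, -, rfl | rfl⟩ <;> simp [Instr.target]
  · simp only [List.mem_cons, List.not_mem_nil, or_false] at h
    simp [h, Instr.target]

theorem runCode_accumulate {i z : ℕ} {a b : Fin (2 ^ m)} (l : List (Fin (2 ^ m)))
    (mem : Reg m → S) :
    runCode (l.flatMap fun c => [.mul .tmp (.A i (blk i b) a c) (.B i (blk i a) c b),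
        .add (.C i z a b) (.C i z a b) .tmp]) mem (.C i z a b) =
      mem (.C i z a b) +
        (l.map fun c => mem (.A i (blk i b) a c) * mem (.B i (blk i a) c b)).sum := by
  induction l generalizing mem with
  | nil => simp
  | cons c l ih =>
    rw [List.flatMap_cons, runCode_append, ih]
    simp [runCode_cons, Instr.exec, add_assoc]

theorem runCode_entryCode (i z : ℕ) (a b : Fin (2 ^ m)) (mem : Reg m → S) :
    runCode (entryCode i z a b) mem (.C i z a b) = entryVal i z a b mem := by
  classical
  unfold entryCode entryVal
  split_ifs with h
  · rw [runCode_cons, runCode_accumulate]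
    simp only [Instr.exec, Function.update_self, zero_add]
    rw [← List.sum_toFinset _ ((List.nodup_finRange _).filter _)]
    refine Finset.sum_congr ?_ fun c _ => ?_
    · ext c
      simp
    · rw [Function.update_of_ne (by simp), Function.update_of_ne (by simp)]
  · simp [runCode_cons, Instr.exec]

/-- The entries of products of level `i` for which PE `r` is responsible. -/
def jobs (πC : Layout m) (i : ℕ) (r : Fin (2 ^ (2 * m))) :
    List (ℕ × Fin (2 ^ m) × Fin (2 ^ m)) :=
  (List.range (2 ^ i)).flatMap fun z =>
    (List.finRange (2 ^ m)).flatMap fun a =>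
      (List.finRange (2 ^ m)).flatMap fun b =>
        if homeC πC i z a b = r then [(z, a, b)] else []

theorem mem_jobs {πC : Layout m} {i : ℕ} {r : Fin (2 ^ (2 * m))} {z : ℕ} {a b : Fin (2 ^ m)} :
    (z, a, b) ∈ jobs πC i r ↔ z < 2 ^ i ∧ homeC πC i z a b = r := by
  simp only [jobs, List.mem_flatMap, List.mem_range, List.mem_finRange, true_and]
  constructor
  · rintro ⟨z', hz, a', b', h⟩
    split_ifs at h with hr
    · simp only [List.mem_singleton, Prod.mk.injEq] at h
      obtain ⟨rfl, rfl, rfl⟩ := h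
      exact ⟨hz, hr⟩
    · simp at h
  · rintro ⟨hz, hr⟩
    exact ⟨z, hz, a, b, by simp [hr]⟩

theorem prodCode_eq (πC : Layout m) (i : ℕ) (r : Fin (2 ^ (2 * m))) :
    prodCode πC i r = (jobs πC i r).flatMap fun w => entryCode i w.1 w.2.1 w.2.2 := by
  simp only [prodCode, jobs, List.flatMap_assoc]
  congr 1; ext1 z; congr 1; ext1 a; congr 1; ext1 b
  split_ifs <;> simp

theorem runCode_entryCodes (i : ℕ) (l : List (ℕ × Fin (2 ^ m) × Fin (2 ^ m))) (mem : Reg m → S)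
    {w : ℕ × Fin (2 ^ m) × Fin (2 ^ m)} (hw : w ∈ l) :
    runCode (l.flatMap fun w => entryCode i w.1 w.2.1 w.2.2) mem (.C i w.1 w.2.1 w.2.2) =
      entryVal i w.1 w.2.1 w.2.2 mem := by
  -- Looking at the last job avoids any assumption that jobs are distinct: either it is `w`, and the
  -- earlier jobs did not alter what it reads, or it does not touch the result for `w`.
  induction l using List.reverseRecOn with
  | nil => simp at hw
  | append_singleton l v ih =>
    rw [List.flatMap_append, runCode_append, List.flatMap_cons, List.flatMap_nil, List.append_nil]
    by_cases hv : v = w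
    · subst hv
      rw [runCode_entryCode]
      refine entryVal_congr fun e h1 h2 => runCode_of_target_ne (fun a ha => ?_) mem
      obtain ⟨u, -, hu⟩ := List.mem_flatMap.1 ha
      rcases target_of_mem_entryCode hu with h | h
      · exact fun h' => h1 _ _ _ (h'.symm.trans h)
      · exact fun h' => h2 (h'.symm.trans h)
    · have hw' : w ∈ l := by
        rcases List.mem_append.1 hw with h | h
        · exact h
        · exact absurd (List.mem_singleton.1 h).symm hv
      rw [runCode_of_target_ne, ih hw']
      intro a ha
      rcases target_of_mem_entryCode ha with h | h
      · rw [h]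
        intro h'
        simp only [Reg.C.injEq, true_and] at h'
        exact hv (Prod.ext h'.1 (Prod.ext h'.2.1 h'.2.2))
      · simp [h]

theorem runCode_prodCode {πC : Layout m} {i z : ℕ} {a b : Fin (2 ^ m)} (hz : z < 2 ^ i)
    (mem : Reg m → S) :
    runCode (prodCode πC i (homeC πC i z a b)) mem (.C i z a b) = entryVal i z a b mem := by
  rw [prodCode_eq]
  exact runCode_entryCodes i _ mem (w := (z, a, b)) (mem_jobs.2 ⟨hz, rfl⟩)

theorem target_of_mem_prodCode {πC : Layout m} {i : ℕ} {r : Fin (2 ^ (2 * m))} {x : Instr (Reg m)}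
    (h : x ∈ prodCode πC i r) : (∃ z a b, x.target = .C i z a b) ∨ x.target = .tmp := by
  rw [prodCode_eq] at h
  obtain ⟨u, -, hu⟩ := List.mem_flatMap.1 h
  exact (target_of_mem_entryCode hu).imp_left fun h => ⟨_, _, _, h⟩

/-- The inputs of all subproblems of level `i` are available. -/
def HasInputs (πA πB : Layout m) (inst : Entry (2 ^ m) → S) (i : ℕ)
    (mem : Fin (2 ^ (2 * m)) → Reg m → S) : Prop :=
  (∀ y < 2 ^ i, ∀ a c, mem (homeA πA i y a c) (.A i y a c) = inst (.A a c)) ∧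
    ∀ x < 2 ^ i, ∀ c b, mem (homeB πB i x c b) (.B i x c b) = inst (.B c b)

theorem mem_triples {i y : ℕ} (hy : y < 2 ^ i) (a c : Fin (2 ^ m)) : (a, c, y) ∈ triples m i := by
  simp [triples, hy]

theorem HasInputs.distStep {πA πB : Layout m} {inst : Entry (2 ^ m) → S} {i : ℕ}
    {mem : Fin (2 ^ (2 * m)) → Reg m → S} (h : HasInputs πA πB inst i mem) (hi : i < levels m) :
    HasInputs πA πB inst (i + 1) (Step.exec mem (distStep πA πB i hi)) := by
  classical
  have hlt : ∀ {y}, y < 2 ^ (i + 1) → y / 2 < 2 ^ i := by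
    intro y hy
    rw [pow_succ] at hy
    omega
  constructor
  · intro y hy a c
    refine (Step.exec_of_mem mem (MM.distStep πA πB i hi) (μ := ⟨homeA πA i (y / 2) a c,
      homeA πA (i + 1) y a c, .A i (y / 2) a c, .A (i + 1) y a c⟩) ?_).trans (h.1 _ (hlt hy) a c)
    exact Finset.mem_union_left _ (Finset.mem_union_left _
      (Finset.mem_image.2 ⟨(a, c, y), mem_triples hy a c, rfl⟩))
  · intro y hy a c
    refine (Step.exec_of_mem mem (MM.distStep πA πB i hi) (μ := ⟨homeB πB i (y / 2) a c,
      homeB πB (i + 1) y a c, .B i (y / 2) a c, .B (i + 1) y a c⟩) ?_).trans (h.2 _ (hlt hy) a c)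
    exact Finset.mem_union_left _ (Finset.mem_union_right _
      (Finset.mem_image.2 ⟨(a, c, y), mem_triples hy a c, rfl⟩))

/-- The entry `(a, b)` of the product of the subproblems of level `i` with third coordinate `z`. -/
def partialProduct (inst : Entry (2 ^ m) → S) (i z : ℕ) (a b : Fin (2 ^ m)) : S :=
  ∑ c : Fin (2 ^ m) with blk i c = z, inst (.A a c) * inst (.B c b)

/-- The values from which the products of level `i` are computed are available. -/
def Ready (πC : Layout m) (inst : Entry (2 ^ m) → S) (i : ℕ)
    (mem : Fin (2 ^ (2 * m)) → Reg m → S) : Prop :=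
  ∀ z < 2 ^ i, ∀ a b, entryVal i z a b (mem (homeC πC i z a b)) = partialProduct inst i z a b

theorem blk_lt {i : ℕ} (hi : i ≤ m) (a : Fin (2 ^ m)) : blk i a < 2 ^ i := by
  rw [blk, Nat.div_lt_iff_lt_mul (by positivity), ← pow_add, Nat.add_sub_cancel' hi]
  exact a.isLt

/-- Subproblems of the last level are solved by single PEs. -/
theorem spread_levels (hm : 1 ≤ m) {g : ℕ} (hg : g < 8 ^ levels m) (a b a' b' : Fin (2 ^ m)) :
    spread m (levels m) g a b = spread m (levels m) g a' b' := by
  have hL := levels_le hm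
  have key : ∀ a b : Fin (2 ^ m), (spread m (levels m) g a b).val =
      g / 2 ^ (levels m - 2 * (m - levels m)) := by
    intro a b
    -- As `3 * levels m ≥ 2 * m`, the piece length is a multiple of the list length of a subproblem,
    -- so no list is cut.
    have e : 2 ^ levels m = 4 ^ (m - levels m) * 2 ^ (levels m - 2 * (m - levels m)) := by
      rw [show (4 : ℕ) = 2 ^ 2 by norm_num, ← pow_mul, ← pow_add]
      congr 1
      unfold levels
      omega
    rw [spread_val hL hg]
    conv_lhs => rw [e]
    rw [← Nat.div_div_eq_div_mul, add_comm, Nat.add_mul_div_right _ _ (by positivity),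
      Nat.div_eq_of_lt (offset_lt _ a b), zero_add]
  exact Fin.ext ((key a b).trans (key a' b').symm)

/-- The factors needed for an entry of a last-level product belong to the same subproblem as that
entry, and all of this subproblem sits at one PE. -/
theorem HasInputs.ready {πA πB : Layout m} {inst : Entry (2 ^ m) → S} (hm : 1 ≤ m)
    {mem : Fin (2 ^ (2 * m)) → Reg m → S} (h : HasInputs πA πB inst (levels m) mem)
    (πC : Layout m) : Ready πC inst (levels m) mem := by
  intro z hz a b
  rw [entryVal, if_pos rfl]
  refine Finset.sum_congr rfl fun c hc => ?_
  have hc' : blk (levels m) c = z := (Finset.mem_filter.1 hc).2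
  have hL := levels_le hm
  have h0 := (levels_pos hm).ne'
  have eA : homeC πC (levels m) z a b = homeA πA (levels m) (blk (levels m) b) a c := by
    rw [homeC, homeA, if_neg h0, if_neg h0, hc']
    exact spread_levels hm (seg_lt ..) ..
  have eB : homeC πC (levels m) z a b = homeB πB (levels m) (blk (levels m) a) c b := by
    rw [homeC, homeB, if_neg h0, if_neg h0, hc']
    exact spread_levels hm (seg_lt ..) ..
  have h1 := h.1 _ (blk_lt hL b) a c
  have h2 := h.2 _ (blk_lt hL a) c b
  rw [← eA] at h1
  rw [← eB] at h2
  rw [h1, h2]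

theorem partialProduct_succ (inst : Entry (2 ^ m) → S) {i : ℕ} (hi : i + 1 ≤ m) (z : ℕ)
    (a b : Fin (2 ^ m)) :
    partialProduct inst (i + 1) (2 * z) a b + partialProduct inst (i + 1) (2 * z + 1) a b =
      partialProduct inst i z a b := by
  rw [partialProduct, partialProduct, partialProduct, ← Finset.sum_union]
  · refine Finset.sum_congr ?_ fun _ _ => rfl
    ext c
    have := blk_succ hi c
    simp only [Finset.mem_union, Finset.mem_filter, Finset.mem_univ, true_and]
    omega
  · rw [Finset.disjoint_left]
    intro c h1 h2
    have h1 := (Finset.mem_filter.1 h1).2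
    have h2 := (Finset.mem_filter.1 h2).2
    omega

/-- The products of level `i + 1` are evaluated and sent in the same superstep. This is why `Ready`
speaks of values yet to be computed rather than of stored products. -/
theorem Ready.collStep {πC : Layout m} {inst : Entry (2 ^ m) → S} {i : ℕ}
    {mem : Fin (2 ^ (2 * m)) → Reg m → S} (h : Ready πC inst (i + 1) mem) (hi : i < levels m) :
    Ready πC inst i (Step.exec mem (collStep πC i hi)) := by
  classical
  intro z hz a b
  have key : ∀ z' < 2 ^ (i + 1), z' / 2 = z →
      Step.exec mem (MM.collStep πC i hi) (homeC πC i z a b) (.C (i + 1) z' a b) =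
        partialProduct inst (i + 1) z' a b := by
    rintro z' hz' rfl
    refine (Step.exec_of_mem mem (MM.collStep πC i hi) (μ := ⟨homeC πC (i + 1) z' a b,
      homeC πC i (z' / 2) a b, .C (i + 1) z' a b, .C (i + 1) z' a b⟩) ?_).trans ?_
    · exact Finset.mem_union_left _ (Finset.mem_image.2 ⟨(a, b, z'), mem_triples hz' a b, rfl⟩)
    · exact (runCode_prodCode hz' _).trans (h z' hz' a b)
  rw [pow_succ] at key
  rw [entryVal, if_neg hi.ne, key _ (by omega) (by omega), key _ (by omega) (by omega),
    partialProduct_succ inst (level_le hi).1]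

theorem Ready.lastStep {πC : Layout m} {inst : Entry (2 ^ m) → S}
    {mem : Fin (2 ^ (2 * m)) → Reg m → S} (h : Ready πC inst 0 mem) (hi : 0 < levels m)
    (a b : Fin (2 ^ m)) :
    Step.exec mem (lastStep πC hi) (πC (a, b)) (.C 0 0 a b) =
      ∑ c, inst (.A a c) * inst (.B c b) := by
  classical
  rw [Step.exec_of_not_mem]
  · refine (runCode_prodCode (πC := πC) (i := 0) (z := 0) (by simp) _).trans ?_
    refine (h 0 (by simp) a b).trans ?_
    rw [partialProduct]
    refine Finset.sum_congr ?_ fun _ _ => rfl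
    ext c
    simp [blk]
  · intro μ hμ _ h2
    obtain ⟨t, ht⟩ := dummies_reg μ hμ
    rw [ht] at h2
    simp at h2

variable (hm : 1 ≤ m) (πA πB πC : Layout m)

theorem hasInputs_start (inst : Entry (2 ^ m) → S) :
    HasInputs πA πB inst 0 ((algorithm hm πA πB πC).start inst) := by
  constructor
  · intro y hy a c
    obtain rfl : y = 0 := by simpa using hy
    simp [Algorithm.start, algorithm, homeA]
  · intro y hy a c
    obtain rfl : y = 0 := by simpa using hy
    simp [Algorithm.start, algorithm, homeB]

theorem algorithm_solves : (algorithm hm πA πB πC).Solves := by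
  intro S _ A B a b
  have h1 := foldl_finRange_induction (HasInputs πA πB (Entry.val A B))
    (fun mem (i : Fin (levels m)) => Step.exec mem (distStep πA πB i i.isLt))
    (hasInputs_start hm πA πB πC (Entry.val A B)) fun i mem h => h.distStep i.isLt
  have h2 := foldl_finRange_reverse_induction (Ready πC (Entry.val A B))
    (fun mem (i : Fin (levels m)) => Step.exec mem (collStep πC i i.isLt))
    (h1.ready hm πC) fun i mem h => h.collStep i.isLt
  have h3 := h2.lastStep (levels_pos hm) a b
  rw [Matrix.mul_apply]
  refine Eq.trans ?_ h3
  simp only [Algorithm.final, algorithm, List.foldl_append, List.foldl_map, List.foldl_cons,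
    List.foldl_nil]

/-! ### Initial replication and the places of the multiplications -/

theorem input_eq_some {r : Fin (2 ^ (2 * m))} {d : Reg m} {e : Entry (2 ^ m)}
    (h : (algorithm hm πA πB πC).input r d = some e) :
    (∃ a c, d = .A 0 0 a c ∧ e = .A a c ∧ r = πA (a, c)) ∨
      ∃ c b, d = .B 0 0 c b ∧ e = .B c b ∧ r = πB (c, b) := by
  simp only [algorithm] at h
  split at h
  · split_ifs at h with hr
    exact .inl ⟨_, _, rfl, (Option.some.inj h).symm, hr.symm⟩
  · split_ifs at h with hr
    exact .inr ⟨_, _, rfl, (Option.some.inj h).symm, hr.symm⟩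
  · simp at h

theorem algorithm_noReplication : (algorithm hm πA πB πC).NoReplication := by
  intro e r r' d d' h h'
  rcases input_eq_some hm πA πB πC h with ⟨a, c, rfl, rfl, rfl⟩ | ⟨a, c, rfl, rfl, rfl⟩ <;>
    rcases input_eq_some hm πA πB πC h' with ⟨a', c', rfl, h, rfl⟩ | ⟨a', c', rfl, h, rfl⟩ <;>
      simp at h
  all_goals
    obtain ⟨rfl, rfl⟩ := h
    exact ⟨rfl, rfl⟩

/-- The registers for copies of input entries hold nothing else. -/
def OnlyCopies (inst : Entry (2 ^ m) → S) (mem : Fin (2 ^ (2 * m)) → Reg m → S) : Prop :=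
  (∀ r i y a c, mem r (.A i y a c) = 0 ∨ mem r (.A i y a c) = inst (.A a c)) ∧
    ∀ r i x c b, mem r (.B i x c b) = 0 ∨ mem r (.B i x c b) = inst (.B c b)

variable {πA πB πC}

theorem OnlyCopies.runCode {inst : Entry (2 ^ m) → S} {mem : Fin (2 ^ (2 * m)) → Reg m → S}
    (h : OnlyCopies inst mem) (code : Fin (2 ^ (2 * m)) → List (Instr (Reg m)))
    (hc : ∀ r, ∀ x ∈ code r, (∃ i z a b, x.target = .C i z a b) ∨ x.target = .tmp) :
    OnlyCopies inst fun r => _root_.runCode (code r) (mem r) := by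
  have hA : ∀ r i y a c, _root_.runCode (code r) (mem r) (.A i y a c) = mem r (.A i y a c) :=
    fun r i y a c => runCode_of_target_ne (fun x hx => by
      rcases hc r x hx with ⟨i, z, a, b, h⟩ | h <;> simp [h]) _
  have hB : ∀ r i y a c, _root_.runCode (code r) (mem r) (.B i y a c) = mem r (.B i y a c) :=
    fun r i y a c => runCode_of_target_ne (fun x hx => by
      rcases hc r x hx with ⟨i, z, a, b, h⟩ | h <;> simp [h]) _
  refine ⟨fun r i y a c => ?_, fun r i y a c => ?_⟩
  · simp only [hA]
    exact h.1 r i y a c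
  · simp only [hB]
    exact h.2 r i y a c

/-- The messages of a step preserve the contents of the registers for copies of input entries. -/
theorem OnlyCopies.exec {inst : Entry (2 ^ m) → S} {mem : Fin (2 ^ (2 * m)) → Reg m → S}
    (h : OnlyCopies inst mem) (st : Step (2 * m) (Reg m))
    (hc : ∀ r, ∀ x ∈ st.code r, (∃ i z a b, x.target = .C i z a b) ∨ x.target = .tmp)
    (hA : ∀ μ ∈ st.msgs, ∀ i y a c, μ.dstReg = .A i y a c → ∃ i y, μ.srcReg = .A i y a c)
    (hB : ∀ μ ∈ st.msgs, ∀ i y a c, μ.dstReg = .B i y a c → ∃ i y, μ.srcReg = .B i y a c) :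
    OnlyCopies inst (Step.exec mem st) := by
  have h' := h.runCode st.code hc
  refine ⟨fun r i y a c => ?_, fun r i y a c => ?_⟩
  · rcases Step.exec_cases mem st r (.A i y a c) with ⟨μ, hμ, -, hd, hv⟩ | hv
    · obtain ⟨i', y', hs⟩ := hA μ hμ i y a c hd
      rw [hv, hs]
      exact h'.1 ..
    · rw [hv]
      exact h'.1 ..
  · rcases Step.exec_cases mem st r (.B i y a c) with ⟨μ, hμ, -, hd, hv⟩ | hv
    · obtain ⟨i', y', hs⟩ := hB μ hμ i y a c hd
      rw [hv, hs]
      exact h'.2 ..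
    · rw [hv]
      exact h'.2 ..

/-- The three kinds of steps of the algorithm. -/
theorem mem_steps {st : Step (2 * m) (Reg m)}
    (h : @Membership.mem (Step (2 * m) (Reg m)) (List (Step (2 * m) (Reg m))) _
      (algorithm hm πA πB πC).steps st) :
    (∃ i, ∃ hi : i < levels m, st = distStep πA πB i hi) ∨
      (∃ i, ∃ hi : i < levels m, st = collStep πC i hi) ∨ st = lastStep πC (levels_pos hm) := by
  simp only [algorithm, List.mem_append, List.mem_map, List.mem_reverse, List.mem_finRange,
    true_and, List.mem_singleton] at h
  rcases h with (⟨i, rfl⟩ | ⟨i, rfl⟩) | rfl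
  · exact .inl ⟨i, i.isLt, rfl⟩
  · exact .inr (.inl ⟨i, i.isLt, rfl⟩)
  · exact .inr (.inr rfl)

theorem OnlyCopies.step {inst : Entry (2 ^ m) → S} {mem : Fin (2 ^ (2 * m)) → Reg m → S}
    (h : OnlyCopies inst mem) {st : Step (2 * m) (Reg m)}
    (hst : st ∈ (algorithm hm πA πB πC).steps) : OnlyCopies inst (Step.exec mem st) := by
  classical
  have hd : ∀ {i} {μ : Message (2 * m) (Reg m)}, μ ∈ dummies m i → ∀ i y a c,
      μ.dstReg ≠ .A i y a c ∧ μ.dstReg ≠ .B i y a c := by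
    intro i μ hμ
    obtain ⟨t, ht⟩ := dummies_reg μ hμ
    simp [ht]
  rcases mem_steps hm hst with ⟨i, hi, rfl⟩ | ⟨i, hi, rfl⟩ | rfl
  · refine h.exec _ (by simp [distStep]) ?_ ?_
    · intro μ hμ j y a c e
      simp only [distStep, distMsgs, Finset.mem_union, Finset.mem_image] at hμ
      rcases hμ with (⟨w, -, rfl⟩ | ⟨w, -, rfl⟩) | hμ
      · simp only [Reg.A.injEq] at e
        obtain ⟨-, -, rfl, rfl⟩ := e
        exact ⟨_, _, rfl⟩
      · simp at e
      · exact absurd e (hd hμ ..).1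
    · intro μ hμ j y a c e
      simp only [distStep, distMsgs, Finset.mem_union, Finset.mem_image] at hμ
      rcases hμ with (⟨w, -, rfl⟩ | ⟨w, -, rfl⟩) | hμ
      · simp at e
      · simp only [Reg.B.injEq] at e
        obtain ⟨-, -, rfl, rfl⟩ := e
        exact ⟨_, _, rfl⟩
      · exact absurd e (hd hμ ..).2
  · have hn : ∀ μ ∈ (collStep πC i hi).msgs, ∀ i y a c,
        μ.dstReg ≠ .A i y a c ∧ μ.dstReg ≠ .B i y a c := by
      intro μ hμ j y a c
      simp only [collStep, collMsgs, Finset.mem_union, Finset.mem_image] at hμ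
      rcases hμ with ⟨w, -, rfl⟩ | hμ
      · simp
      · exact hd hμ ..
    exact h.exec _ (fun r x hx => (target_of_mem_prodCode hx).imp_left fun h => ⟨_, h⟩)
      (fun μ hμ i y a c e => absurd e (hn μ hμ ..).1)
      (fun μ hμ i y a c e => absurd e (hn μ hμ ..).2)
  · exact h.exec _ (fun r x hx => (target_of_mem_prodCode hx).imp_left fun h => ⟨_, h⟩)
      (fun μ hμ i y a c e => absurd e (hd (i := 0) hμ ..).1)
      (fun μ hμ i y a c e => absurd e (hd (i := 0) hμ ..).2)

theorem onlyCopies_start (inst : Entry (2 ^ m) → S) :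
    OnlyCopies inst ((algorithm hm πA πB πC).start inst) := by
  have key : ∀ r d, (algorithm hm πA πB πC).start inst r d = 0 ∨
      ∃ e, (algorithm hm πA πB πC).input r d = some e ∧
        (algorithm hm πA πB πC).start inst r d = inst e := by
    intro r d
    simp only [Algorithm.start]
    cases h : (algorithm hm πA πB πC).input r d with
    | none => exact .inl rfl
    | some e => exact .inr ⟨e, rfl, rfl⟩
  refine ⟨fun r i y a c => (key r (.A i y a c)).imp_right ?_,
    fun r i y a c => (key r (.B i y a c)).imp_right ?_⟩
  · rintro ⟨e, h1, h2⟩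
    rcases input_eq_some hm πA πB πC h1 with ⟨a', c', h3, rfl, -⟩ | ⟨a', c', h3, rfl, -⟩
    · simp only [Reg.A.injEq] at h3
      obtain ⟨rfl, rfl, rfl, rfl⟩ := h3
      exact h2
    · simp at h3
  · rintro ⟨e, h1, h2⟩
    rcases input_eq_some hm πA πB πC h1 with ⟨a', c', h3, rfl, -⟩ | ⟨a', c', h3, rfl, -⟩
    · simp at h3
    · simp only [Reg.B.injEq] at h3
      obtain ⟨rfl, rfl, rfl, rfl⟩ := h3
      exact h2

theorem OnlyCopies.foldl {inst : Entry (2 ^ m) → S} {mem : Fin (2 ^ (2 * m)) → Reg m → S}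
    (h : OnlyCopies inst mem) {l : List (Step (2 * m) (Reg m))}
    (hl : ∀ st ∈ l, st ∈ (algorithm hm πA πB πC).steps) :
    OnlyCopies inst (l.foldl Step.exec mem) := by
  induction l generalizing mem with
  | nil => exact h
  | cons st l ih =>
    exact ih (h.step hm (hl st List.mem_cons_self)) fun s hs => hl s (List.mem_cons_of_mem _ hs)

theorem mul_mem_prodCode {i : ℕ} {r : Fin (2 ^ (2 * m))} {d x y : Reg m}
    (h : Instr.mul d x y ∈ prodCode πC i r) :
    i = levels m ∧ ∃ a b c, homeC πC i (blk i c) a b = r ∧ x = .A i (blk i b) a c ∧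
      y = .B i (blk i a) c b := by
  rw [prodCode_eq] at h
  obtain ⟨⟨z, a, b⟩, hw, h⟩ := List.mem_flatMap.1 h
  unfold entryCode at h
  split_ifs at h with hi
  · simp only [List.mem_cons, List.mem_flatMap, List.not_mem_nil, or_false, reduceCtorEq, false_or,
      Instr.mul.injEq, List.mem_filter, decide_eq_true_eq] at h
    obtain ⟨c, ⟨-, rfl⟩, -, rfl, rfl⟩ := h
    exact ⟨hi, a, b, c, (mem_jobs.1 hw).2, rfl, rfl⟩
  · simp at h

/-- Multiplications occur only in the classical algorithm at the last level, on registers for copies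
of inputs. These hold 0 or the entry in their name, so the values of the operands reveal the
registers, and the registers reveal the PE. -/
theorem home_of_mul_input {start : Fin (2 ^ (2 * m)) → Reg m → FreeAlgebra ℕ (Entry (2 ^ m))}
    (h0 : OnlyCopies (FreeAlgebra.ι ℕ) start) {r : Fin (2 ^ (2 * m))}
    {before after : List (Step (2 * m) (Reg m))} {st : Step (2 * m) (Reg m)}
    (hs : (algorithm hm πA πB πC).steps = before ++ st :: after)
    {c₁ c₂ : List (Instr (Reg m))} {d x y : Reg m} (hc : st.code r = c₁ ++ Instr.mul d x y :: c₂)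
    {i l l' j : Fin (2 ^ m)}
    (hx : runCode c₁ (before.foldl Step.exec start r) x = FreeAlgebra.ι ℕ (Entry.A i l))
    (hy : runCode c₁ (before.foldl Step.exec start r) y = FreeAlgebra.ι ℕ (Entry.B l' j)) :
    homeC πC (levels m) (blk (levels m) l) i j = r := by
  classical
  have hmem : ∀ s ∈ before ++ st :: after, @Membership.mem (Step (2 * m) (Reg m))
      (List (Step (2 * m) (Reg m))) _ (algorithm hm πA πB πC).steps s := fun s h => by
    rw [hs]; exact h
  have hst := hmem st (by simp)
  have hcode : ∃ i, st.code r = [] ∨ st.code r = prodCode πC i r := by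
    rcases mem_steps hm hst with ⟨i, hi, rfl⟩ | ⟨i, hi, rfl⟩ | rfl
    · exact ⟨0, .inl rfl⟩
    · exact ⟨_, .inr rfl⟩
    · exact ⟨_, .inr rfl⟩
  obtain ⟨n, hcode | hcode⟩ := hcode
  · rw [hcode] at hc
    simp at hc
  have hsub : ∀ e ∈ c₁, e ∈ prodCode πC n r := by
    intro e he
    rw [← hcode, hc]
    exact List.mem_append_left _ he
  have hmul : Instr.mul d x y ∈ prodCode πC n r := by rw [← hcode, hc]; simp
  obtain ⟨hi, a, b, c, hh, rfl, rfl⟩ := mul_mem_prodCode hmul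
  have hbef : OnlyCopies (FreeAlgebra.ι ℕ) (before.foldl Step.exec start) :=
    h0.foldl hm fun s hs' => hmem s (List.mem_append_left _ hs')
  have hA := hbef.1 r n (blk n b) a c
  have hB := hbef.2 r n (blk n a) c b
  rw [runCode_of_target_ne (fun x hx => by
      rcases target_of_mem_prodCode (hsub x hx) with ⟨z, a, b, h⟩ | h <;> simp [h])] at hx hy
  -- A generator is not 0, so the register holds its own entry; generators are distinct, so the
  -- indices agree.
  have hA' := FreeAlgebra.ι_injective
    (hx.symm.trans (hA.resolve_left fun h => FreeAlgebra.ι_ne_zero _ (hx.symm.trans h)))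
  have hB' := FreeAlgebra.ι_injective
    (hy.symm.trans (hB.resolve_left fun h => FreeAlgebra.ι_ne_zero _ (hy.symm.trans h)))
  simp only [Entry.A.injEq, Entry.B.injEq] at hA' hB'
  rw [hA'.1, hA'.2, hB'.2, ← hi]
  exact hh

theorem home_of_computes {r : Fin (2 ^ (2 * m))} {t : Fin (2 ^ m) × Fin (2 ^ m) × Fin (2 ^ m)}
    (h : (algorithm hm πA πB πC).Computes r t) :
    homeC πC (levels m) (blk (levels m) t.2.1) t.1 t.2.2 = r := by
  obtain ⟨before, after, st, c₁, c₂, d, x, y, hs, hc, hx, hy⟩ := h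
  exact home_of_mul_input hm (onlyCopies_start hm _) hs hc hx hy

end MM

/-! ### Degrees of folded steps -/

namespace Algorithm

variable {k : ℕ} {Reg : Type}

theorem card_block_msgs_le {j : ℕ} (hj : j ≤ k) (s : Finset (Message k Reg))
    (f : Message k Reg → Fin (2 ^ k)) {D : ℕ} (h : ∀ r, (s.filter fun μ => f μ = r).card ≤ D)
    (R : Fin (2 ^ j)) : (s.filter fun μ => block hj (f μ) = R).card ≤ D * 2 ^ (k - j) := by
  rw [Finset.card_eq_sum_card_fiberwise (f := f)
    (t := Finset.univ.filter fun r => block hj r = R) (fun μ hμ => by simpa using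
      (Finset.mem_filter.1 (Finset.mem_coe.1 hμ)).2)]
  refine (Finset.sum_le_card_nsmul _ _ D fun r _ => ?_).trans ?_
  · exact (Finset.card_le_card (Finset.filter_subset_filter _ (Finset.filter_subset _ _))).trans
      (h r)
  · rw [smul_eq_mul, mul_comm]
    exact Nat.mul_le_mul_left _ (card_block hj R)

/-- A folded PE handles at most the messages of the `2 ^ (k - j)` PEs that it hosts. -/
theorem degree_foldStep_le {j : ℕ} (hj : j ≤ k) (st : Step k Reg) {D : ℕ}
    (hs : ∀ r, (st.msgs.filter fun μ => μ.src = r).card ≤ D)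
    (hd : ∀ r, (st.msgs.filter fun μ => μ.dst = r).card ≤ D) :
    (foldStep hj st).degree ≤ D * 2 ^ (k - j) := by
  classical
  refine Finset.sup_le fun R _ => max_le ?_ ?_
  · refine le_trans ?_ (card_block_msgs_le hj st.msgs Message.src hs R)
    simp only [foldStep, Finset.filter_image]
    refine Finset.card_image_le.trans (Finset.card_le_card ?_)
    exact Finset.monotone_filter_right _ fun μ _ h => h.1
  · refine le_trans ?_ (card_block_msgs_le hj st.msgs Message.dst hd R)
    simp only [foldStep, Finset.filter_image]
    refine Finset.card_image_le.trans (Finset.card_le_card ?_)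
    exact Finset.monotone_filter_right _ fun μ _ h => h.1

end Algorithm

namespace MM

variable {m : ℕ}

/-! ### Even spreading of the entries and degrees of the supersteps -/

theorem seg_inj {i x y z x' y' z' : ℕ} (hx : x < 2 ^ i) (hy : y < 2 ^ i) (hz : z < 2 ^ i)
    (hx' : x' < 2 ^ i) (hy' : y' < 2 ^ i) (hz' : z' < 2 ^ i)
    (h : seg i x y z = seg i x' y' z') : x = x' ∧ y = y' ∧ z = z' := by
  induction i generalizing x y z x' y' z' with
  | zero => simp at *; omega
  | succ i ih =>
    simp only [pow_succ] at *
    -- An octal digit of the number is made of one binary digit of each coordinate.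
    have h1 := ih (x := x / 2) (y := y / 2) (z := z / 2) (x' := x' / 2) (y' := y' / 2)
      (z' := z' / 2) (by omega) (by omega) (by omega) (by omega) (by omega) (by omega)
      (by simp only [seg] at h; omega)
    have h2 : 4 * (x % 2) + 2 * (y % 2) + z % 2 = 4 * (x' % 2) + 2 * (y' % 2) + z' % 2 := by
      simp only [seg] at h; omega
    omega

theorem add_mul_inj {q g g' o o' : ℕ} (ho : o < q) (ho' : o' < q) (h : g * q + o = g' * q + o') :
    g = g' ∧ o = o' := by
  have hq : 0 < q := by omega
  have h1 := congrArg (· / q) h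
  have h2 := congrArg (· % q) h
  simp only [add_comm (_ * q), Nat.add_mul_div_right _ _ hq, Nat.div_eq_of_lt ho,
    Nat.div_eq_of_lt ho', zero_add, Nat.add_mul_mod_self_right, Nat.mod_eq_of_lt ho,
    Nat.mod_eq_of_lt ho'] at h1 h2
  exact ⟨h1, h2⟩

theorem mod_inj {i : ℕ} {a b a' b' : Fin (2 ^ m)}
    (h : a.val % 2 ^ (m - i) * 2 ^ (m - i) + b.val % 2 ^ (m - i) =
      a'.val % 2 ^ (m - i) * 2 ^ (m - i) + b'.val % 2 ^ (m - i))
    (ha : blk i a = blk i a') (hb : blk i b = blk i b') : a = a' ∧ b = b' := by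
  obtain ⟨h1, h2⟩ := add_mul_inj (Nat.mod_lt _ (by positivity)) (Nat.mod_lt _ (by positivity)) h
  unfold blk at ha hb
  constructor
  · apply Fin.ext
    rw [← Nat.div_add_mod a.val (2 ^ (m - i)), ha, h1, Nat.div_add_mod]
  · apply Fin.ext
    rw [← Nat.div_add_mod b.val (2 ^ (m - i)), hb, h2, Nat.div_add_mod]

/-- Numberings of the subproblems of level `i` that contain given entries. -/
def Numbering (i : ℕ) (f : Fin (2 ^ m) → Fin (2 ^ m) → ℕ → ℕ) : Prop :=
  (∀ a b y, f a b y < 8 ^ i) ∧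
    ∀ a b y a' b' y', y < 2 ^ i → y' < 2 ^ i → f a b y = f a' b' y' →
      blk i a = blk i a' ∧ blk i b = blk i b' ∧ y = y'

/-- Quotient and remainder modulo `2 ^ i` give the position in the concatenated list; this gives the
number of the subproblem and the offset in its block, hence block coordinates and local coordinates.
-/
theorem eq_of_spread {i : ℕ} (hi : i ≤ m) {f : Fin (2 ^ m) → Fin (2 ^ m) → ℕ → ℕ}
    (hf : Numbering i f) {a b a' b' : Fin (2 ^ m)} {y y' : ℕ} (hy : y < 2 ^ i) (hy' : y' < 2 ^ i)
    (h : spread m i (f a b y) a b = spread m i (f a' b' y') a' b')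
    (h' : (f a b y * 4 ^ (m - i) +
        (a.val % 2 ^ (m - i) * 2 ^ (m - i) + b.val % 2 ^ (m - i))) % 2 ^ i =
      (f a' b' y' * 4 ^ (m - i) +
        (a'.val % 2 ^ (m - i) * 2 ^ (m - i) + b'.val % 2 ^ (m - i))) % 2 ^ i) :
    a = a' ∧ b = b' ∧ y = y' := by
  have h1 := congrArg Fin.val h
  rw [spread_val hi (hf.1 ..), spread_val hi (hf.1 ..)] at h1
  have h2 : f a b y * 4 ^ (m - i) +
        (a.val % 2 ^ (m - i) * 2 ^ (m - i) + b.val % 2 ^ (m - i)) =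
      f a' b' y' * 4 ^ (m - i) +
        (a'.val % 2 ^ (m - i) * 2 ^ (m - i) + b'.val % 2 ^ (m - i)) := by
    rw [← Nat.div_add_mod (f a b y * 4 ^ (m - i) + _) (2 ^ i), h1, h', Nat.div_add_mod]
  obtain ⟨h3, h4⟩ := add_mul_inj (offset_lt i a b) (offset_lt i a' b') h2
  obtain ⟨h5, h6, h7⟩ := hf.2 _ _ _ _ _ _ hy hy' h3
  obtain ⟨h8, h9⟩ := mod_inj h4 h5 h6
  exact ⟨h8, h9, h7⟩

/-- Entries at one PE are told apart by their place in its piece of length `2 ^ i`; at level 0 there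
is one entry per PE, as the layout is a bijection. -/
theorem card_home_le {i : ℕ} (hi : i ≤ m) (π : Layout m) {f : Fin (2 ^ m) → Fin (2 ^ m) → ℕ → ℕ}
    (hf : Numbering i f) (r : Fin (2 ^ (2 * m))) :
    ((triples m i).filter fun w =>
      (if i = 0 then π (w.1, w.2.1) else spread m i (f w.1 w.2.1 w.2.2) w.1 w.2.1) = r).card ≤
        2 ^ i := by
  rw [← Finset.card_range (2 ^ i)]
  apply Finset.card_le_card_of_injOn (fun w => (f w.1 w.2.1 w.2.2 * 4 ^ (m - i) +
        (w.1.val % 2 ^ (m - i) * 2 ^ (m - i) + w.2.1.val % 2 ^ (m - i))) % 2 ^ i)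
  · intro w _
    simpa using Nat.mod_lt _ (by positivity)
  · rintro ⟨a, b, y⟩ hw ⟨a', b', y'⟩ hw' h
    simp only [triples, Finset.coe_filter, Finset.mem_product, Finset.mem_univ, true_and,
      Finset.mem_range, Set.mem_ofPred_eq] at hw hw'
    rcases Nat.eq_zero_or_pos i with rfl | h0
    · simp only [if_true, pow_zero, Nat.lt_one_iff] at hw hw'
      have := π.injective (hw.2.trans hw'.2.symm)
      simp only [Prod.mk.injEq] at this ⊢
      exact ⟨this.1, this.2, hw.1.trans hw'.1.symm⟩
    · rw [if_neg h0.ne'] at hw hw'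
      obtain ⟨rfl, rfl, rfl⟩ := eq_of_spread hi hf hw.1 hw'.1 (hw.2.trans hw'.2.symm) h
      rfl

theorem numberingA {i : ℕ} (hi : i ≤ m) :
    Numbering (m := m) i fun a c y => seg i (blk i a) y (blk i c) :=
  ⟨fun _ _ _ => seg_lt .., fun a b y a' b' y' hy hy' h => by
    obtain ⟨h1, h2, h3⟩ := seg_inj (blk_lt hi a) hy (blk_lt hi b) (blk_lt hi a') hy' (blk_lt hi b') h
    exact ⟨h1, h3, h2⟩⟩

theorem numberingB {i : ℕ} (hi : i ≤ m) :
    Numbering (m := m) i fun c b x => seg i x (blk i b) (blk i c) :=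
  ⟨fun _ _ _ => seg_lt .., fun a b y a' b' y' hy hy' h => by
    obtain ⟨h1, h2, h3⟩ := seg_inj hy (blk_lt hi b) (blk_lt hi a) hy' (blk_lt hi b') (blk_lt hi a') h
    exact ⟨h3, h2, h1⟩⟩

theorem numberingC {i : ℕ} (hi : i ≤ m) :
    Numbering (m := m) i fun a b z => seg i (blk i a) (blk i b) z :=
  ⟨fun _ _ _ => seg_lt .., fun a b y a' b' y' hy hy' h => by
    exact seg_inj (blk_lt hi a) (blk_lt hi b) hy (blk_lt hi a') (blk_lt hi b') hy' h⟩

theorem card_homeA_le {i : ℕ} (hi : i ≤ m) (π : Layout m) (r : Fin (2 ^ (2 * m))) :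
    ((triples m i).filter fun w => homeA π i w.2.2 w.1 w.2.1 = r).card ≤ 2 ^ i :=
  card_home_le hi π (numberingA hi) r

theorem card_homeB_le {i : ℕ} (hi : i ≤ m) (π : Layout m) (r : Fin (2 ^ (2 * m))) :
    ((triples m i).filter fun w => homeB π i w.2.2 w.1 w.2.1 = r).card ≤ 2 ^ i :=
  card_home_le hi π (numberingB hi) r

theorem card_homeC_le {i : ℕ} (hi : i ≤ m) (π : Layout m) (r : Fin (2 ^ (2 * m))) :
    ((triples m i).filter fun w => homeC π i w.2.2 w.1 w.2.1 = r).card ≤ 2 ^ i :=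
  card_home_le hi π (numberingC hi) r

/-- Every subproblem has two children with given entries of one of the matrices. -/
theorem card_half_le {i : ℕ} (g : ℕ → Fin (2 ^ m) → Fin (2 ^ m) → Fin (2 ^ (2 * m)))
    (r : Fin (2 ^ (2 * m)))
    (h : ((triples m i).filter fun w => g w.2.2 w.1 w.2.1 = r).card ≤ 2 ^ i) :
    ((triples m (i + 1)).filter fun w => g (w.2.2 / 2) w.1 w.2.1 = r).card ≤ 2 * 2 ^ i := by
  refine le_trans ?_ (Nat.mul_le_mul_left 2 h)
  refine le_trans ?_ (Finset.card_product (Finset.range 2) _).le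
  apply Finset.card_le_card_of_injOn (fun w => (w.2.2 % 2, w.1, w.2.1, w.2.2 / 2))
  · rintro ⟨a, b, y⟩ hw
    simp only [triples, Finset.coe_filter, Finset.mem_product, Finset.mem_univ, true_and,
      Finset.mem_range, Set.mem_ofPred_eq, Finset.coe_product, Set.mem_prod, Finset.mem_coe,
      pow_succ] at hw ⊢
    exact ⟨Nat.mod_lt _ (by norm_num), by omega, hw.2⟩
  · rintro ⟨a, b, y⟩ - ⟨a', b', y'⟩ - h
    simp only [Prod.mk.injEq] at h ⊢
    exact ⟨h.2.1, h.2.2.1, by omega⟩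

theorem card_filter_image_le {α β : Type} [DecidableEq β] (s : Finset α) (f : α → β)
    (p : β → Prop) [DecidablePred p] :
    ((s.image f).filter p).card ≤ (s.filter fun a => p (f a)).card := by
  rw [Finset.filter_image]
  exact Finset.card_image_le

theorem card_filter_union_le {α : Type} [DecidableEq α] (s t : Finset α) (p : α → Prop)
    [DecidablePred p] {a b : ℕ} (hs : (s.filter p).card ≤ a) (ht : (t.filter p).card ≤ b) :
    ((s ∪ t).filter p).card ≤ a + b := by
  rw [Finset.filter_union]
  exact (Finset.card_union_le _ _).trans (Nat.add_le_add hs ht)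

theorem card_dummies_src_le {i : ℕ} (hi : 3 * i + 1 ≤ 2 * m) (r : Fin (2 ^ (2 * m))) :
    ((dummies m i).filter fun μ => μ.src = r).card ≤ 2 ^ i := by
  classical
  refine (card_filter_image_le _ _ _).trans ?_
  refine le_trans ?_ (Finset.card_range (2 ^ i)).le
  apply Finset.card_le_card_of_injOn Prod.snd
  · intro w hw
    exact (Finset.mem_product.1 (Finset.mem_filter.1 (Finset.mem_coe.1 hw)).1).2
  · rintro ⟨t, u⟩ hw ⟨t', u'⟩ hw' h
    simp only [Finset.coe_filter, Finset.mem_product, Finset.mem_range, Set.mem_ofPred_eq]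
      at hw hw' h
    have h1 := congrArg Fin.val (hw.2.trans hw'.2.symm)
    simp only [Fin.val_ofNat] at h1
    rw [Nat.mod_eq_of_lt (dummies_bound hi hw.1.1).1,
      Nat.mod_eq_of_lt (dummies_bound hi hw'.1.1).1] at h1
    exact Prod.ext h1 h

theorem card_dummies_dst_le {i : ℕ} (hi : 3 * i + 1 ≤ 2 * m) (r : Fin (2 ^ (2 * m))) :
    ((dummies m i).filter fun μ => μ.dst = r).card ≤ 2 ^ i := by
  classical
  refine (card_filter_image_le _ _ _).trans ?_
  refine le_trans ?_ (Finset.card_range (2 ^ i)).le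
  apply Finset.card_le_card_of_injOn Prod.snd
  · intro w hw
    exact (Finset.mem_product.1 (Finset.mem_filter.1 (Finset.mem_coe.1 hw)).1).2
  · rintro ⟨t, u⟩ hw ⟨t', u'⟩ hw' h
    simp only [Finset.coe_filter, Finset.mem_product, Finset.mem_range, Set.mem_ofPred_eq]
      at hw hw' h
    have h1 := congrArg Fin.val (hw.2.trans hw'.2.symm)
    simp only [Fin.val_ofNat] at h1
    rw [Nat.mod_eq_of_lt (dummies_bound hi hw.1.1).2.1,
      Nat.mod_eq_of_lt (dummies_bound hi hw'.1.1).2.1] at h1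
    exact Prod.ext (Nat.add_right_cancel h1) h

/-- A `3i`-superstep in which every PE sends and receives `O(2 ^ i)` messages, among them the
dummy messages. -/
structure IsRegular (st : Step (2 * m) (Reg m)) (i : ℕ) : Prop where
  lt : i < levels m
  label : st.label = 3 * i
  dummies : MM.dummies m i ⊆ st.msgs
  src : ∀ r, (st.msgs.filter fun μ => μ.src = r).card ≤ 5 * 2 ^ i
  dst : ∀ r, (st.msgs.filter fun μ => μ.dst = r).card ≤ 5 * 2 ^ i

theorem isRegular_distStep (πA πB : Layout m) {i : ℕ} (hi : i < levels m) :
    IsRegular (distStep πA πB i hi) i := by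
  classical
  obtain ⟨h1, h2⟩ := level_le hi
  refine ⟨hi, rfl, Finset.subset_union_right, fun r => ?_, fun r => ?_⟩
  -- At most `2 ^ i` entries of each of `A` and `B` go out in two copies each, besides `2 ^ i`
  -- dummies: `2 + 2 + 1 = 5`. On the receiving side, `2 ^ (i + 1)` entries of each matrix arrive.
  · refine (card_filter_union_le _ _ _ (card_filter_union_le _ _ _
      ((card_filter_image_le _ _ _).trans (card_half_le (homeA πA i) r
        (card_homeA_le (by omega) πA r)))
      ((card_filter_image_le _ _ _).trans (card_half_le (homeB πB i) r
        (card_homeB_le (by omega) πB r)))) (card_dummies_src_le h2 r)).trans ?_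
    omega
  · refine (card_filter_union_le _ _ _ (card_filter_union_le _ _ _
      ((card_filter_image_le _ _ _).trans (card_homeA_le h1 πA r))
      ((card_filter_image_le _ _ _).trans (card_homeB_le h1 πB r)))
        (card_dummies_dst_le h2 r)).trans ?_
    rw [pow_succ]
    omega

theorem isRegular_collStep (πC : Layout m) {i : ℕ} (hi : i < levels m) :
    IsRegular (collStep πC i hi) i := by
  classical
  obtain ⟨h1, h2⟩ := level_le hi
  refine ⟨hi, rfl, Finset.subset_union_right, fun r => ?_, fun r => ?_⟩
  · refine (card_filter_union_le _ _ _
      ((card_filter_image_le _ _ _).trans (card_homeC_le h1 πC r))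
        (card_dummies_src_le h2 r)).trans ?_
    rw [pow_succ]
    omega
  · refine (card_filter_union_le _ _ _
      ((card_filter_image_le _ _ _).trans (card_half_le (homeC πC i) r
        (card_homeC_le (by omega) πC r))) (card_dummies_dst_le h2 r)).trans ?_
    omega

theorem isRegular_lastStep (πC : Layout m) (h : 0 < levels m) : IsRegular (lastStep πC h) 0 :=
  ⟨h, rfl, Finset.Subset.refl _,
    fun r => (card_dummies_src_le (level_le h).2 r).trans (by omega),
    fun r => (card_dummies_dst_le (level_le h).2 r).trans (by omega)⟩

theorem IsRegular.degree_le {st : Step (2 * m) (Reg m)} {i : ℕ} (h : IsRegular st i) {j : ℕ}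
    (hj : j ≤ 2 * m) : (Algorithm.foldStep hj st).degree ≤ 5 * 2 ^ i * 2 ^ (2 * m - j) :=
  Algorithm.degree_foldStep_le hj st h.src h.dst

/-- The dummy messages keep the first PE of the folded machine busy. -/
theorem IsRegular.le_degree {st : Step (2 * m) (Reg m)} {i : ℕ} (h : IsRegular st i) {j : ℕ}
    (hj : j ≤ 2 * m) (hij : 3 * i < j) :
    2 ^ i * 2 ^ (2 * m - j) ≤ (Algorithm.foldStep hj st).degree := by
  classical
  have hl := (level_le h.lt).2
  have hc : 2 ^ i * 2 ^ (2 * m - j) =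
      (Finset.range (2 ^ i) ×ˢ Finset.range (2 ^ (2 * m - j))).card := by simp
  rw [hc]
  refine le_trans ?_ ((Algorithm.foldStep hj st).card_src_le_degree 0)
  -- As `3 * i + 1 ≤ j`, the stride of the dummy messages is at least the block size: every PE of
  -- the first block sends dummies, and all of them leave the block.
  have hle : 2 ^ (2 * m - j) ≤ 2 ^ (2 * m) / 2 ^ (3 * i + 1) := by
    rw [Nat.pow_div hl (by norm_num)]
    exact Nat.pow_le_pow_right (by norm_num) (by omega)
  apply Finset.card_le_card_of_injOn (fun w : ℕ × ℕ =>
    (⟨Algorithm.block hj (Fin.ofNat _ w.2),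
      Algorithm.block hj (Fin.ofNat _ (w.2 + 2 ^ (2 * m) / 2 ^ (3 * i + 1))),
      (Fin.ofNat _ w.2, .dummy w.1),
      (Fin.ofNat _ (w.2 + 2 ^ (2 * m) / 2 ^ (3 * i + 1)), .dummy w.1)⟩ :
        Message j (Fin (2 ^ (2 * m)) × Reg m)))
  · rintro ⟨u, t⟩ hw
    simp only [Finset.coe_product, Set.mem_prod, Finset.mem_coe, Finset.mem_range] at hw
    have ht := hw.2.trans_le hle
    obtain ⟨h1, h2, -, -⟩ := dummies_bound hl ht
    simp only [Finset.coe_filter, Set.mem_ofPred_eq]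
    refine ⟨?_, ?_, ?_⟩
    · refine Finset.mem_image.2 ⟨_, h.dummies (Finset.mem_image.2 ⟨(t, u), ?_, rfl⟩), rfl⟩
      exact Finset.mem_product.2 ⟨Finset.mem_range.2 ht, Finset.mem_range.2 hw.1⟩
    · apply Fin.ext
      simp only [Algorithm.block, Fin.val_ofNat]
      rw [Nat.mod_eq_of_lt h1]
      exact Nat.div_eq_of_lt hw.2
    · intro e
      have e := congrArg Fin.val e
      simp only [Algorithm.block, Fin.val_ofNat] at e
      rw [Nat.mod_eq_of_lt h2, Fin.val_zero, Nat.div_eq_zero_iff] at e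
      have : 0 < 2 ^ (2 * m - j) := by positivity
      omega
  -- Folding does not merge these messages, since their registers still name the original sender and
  -- the dummy number.
  · rintro ⟨u, t⟩ hw ⟨u', t'⟩ hw' e
    simp only [Finset.coe_product, Set.mem_prod, Finset.mem_coe, Finset.mem_range] at hw hw'
    simp only [Message.mk.injEq, Prod.mk.injEq, Reg.dummy.injEq] at e
    have e1 := congrArg Fin.val e.2.2.1.1
    simp only [Fin.val_ofNat] at e1
    rw [Nat.mod_eq_of_lt (dummies_bound hl (hw.2.trans_le hle)).1,
      Nat.mod_eq_of_lt (dummies_bound hl (hw'.2.trans_le hle)).1] at e1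
    exact Prod.ext e.2.2.1.2 e1

variable (hm : 1 ≤ m) (πA πB πC : Layout m)

theorem exists_isRegular {st : Step (2 * m) (Reg m)}
    (h : @Membership.mem (Step (2 * m) (Reg m)) (List (Step (2 * m) (Reg m))) _
      (algorithm hm πA πB πC).steps st) : ∃ i, IsRegular st i := by
  rcases mem_steps hm h with ⟨i, hi, rfl⟩ | ⟨i, hi, rfl⟩ | rfl
  · exact ⟨i, isRegular_distStep πA πB hi⟩
  · exact ⟨i, isRegular_collStep πC hi⟩
  · exact ⟨0, isRegular_lastStep πC _⟩

/-! ### Membership in the class -/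

theorem algorithm_evenTerms : (algorithm hm πA πB πC).EvenTerms := by
  classical
  intro r
  have hL := levels_le hm
  have h0 := (levels_pos hm).ne'
  have key : {t | (algorithm hm πA πB πC).Computes r t}.ncard ≤ 2 ^ m := by
    have hsub : {t | (algorithm hm πA πB πC).Computes r t}.ncard ≤
        (Finset.univ.filter fun t : Fin (2 ^ m) × Fin (2 ^ m) × Fin (2 ^ m) =>
          homeC πC (levels m) (blk (levels m) t.2.1) t.1 t.2.2 = r).card := by
      rw [← Set.ncard_coe_finset]
      exact Set.ncard_le_ncard (fun t ht => by simpa using home_of_computes hm ht) (Set.toFinite _)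
    refine hsub.trans ?_
    -- A PE is home to at most `2 ^ levels m` last-level product entries, and each has `2 ^ (m -
    -- levels m)` terms, one for each residue of the inner index.
    have e : 2 ^ m = 2 ^ levels m * 2 ^ (m - levels m) := by rw [← pow_add]; congr 1; omega
    refine (Finset.card_le_mul_card_image (f := fun t => t.2.1.val % 2 ^ (m - levels m)) _
      (2 ^ levels m) fun c _ => ?_).trans ?_
    · refine le_trans ?_ (card_homeC_le hL πC r)
      apply Finset.card_le_card_of_injOn (fun t => (t.1, t.2.2, blk (levels m) t.2.1))
      · intro t ht
        simp only [Finset.coe_filter, Finset.mem_filter, Finset.mem_univ, true_and,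
          Set.mem_ofPred_eq] at ht ⊢
        exact ⟨mem_triples (blk_lt hL _) _ _, ht.1⟩
      · rintro ⟨a, l, b⟩ ht ⟨a', l', b'⟩ ht' e
        simp only [Finset.coe_filter, Finset.mem_filter, Finset.mem_univ, true_and,
          Set.mem_ofPred_eq, Prod.mk.injEq] at ht ht' e ⊢
        refine ⟨e.1, Fin.ext ?_, e.2.1⟩
        have e3 := e.2.2
        unfold blk at e3
        rw [← Nat.div_add_mod l.val (2 ^ (m - levels m)), e3, ht.2, ← ht'.2, Nat.div_add_mod]
    · refine le_trans (Nat.mul_le_mul_left _ ?_) e.ge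
      refine le_trans ?_ (Finset.card_range (2 ^ (m - levels m))).le
      refine Finset.card_le_card fun x hx => ?_
      obtain ⟨t, -, rfl⟩ := Finset.mem_image.1 hx
      exact Finset.mem_range.2 (Nat.mod_lt _ (by positivity))
  calc _ ≤ 2 ^ m * 2 ^ (2 * m) := Nat.mul_le_mul_right _ key
    _ = (2 ^ m) ^ 3 := by ring

theorem algorithm_inClass : (algorithm hm πA πB πC).InClass :=
  Algorithm.inClass_of_evenTerms (algorithm_solves hm πA πB πC)
    (algorithm_noReplication hm πA πB πC) (algorithm_evenTerms hm πA πB πC)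

/-- A folding of a folding has differently named registers and is not literally a folding of the
algorithm, so this is not read off from `algorithm_inClass` but from properties closed under
folding. -/
theorem fold_inClass {k : ℕ} (hk : k ≤ 2 * m) :
    ((algorithm hm πA πB πC).fold hk).InClass :=
  Algorithm.inClass_of_evenTerms ((algorithm_solves hm πA πB πC).fold hk)
    ((algorithm_noReplication hm πA πB πC).fold hk) ((algorithm_evenTerms hm πA πB πC).fold hk)

/-! ### Wiseness -/

theorem sum_cumDegree_fold {j : ℕ} (hj : j ≤ 2 * m) (n : ℕ) :
    ∑ i ∈ Finset.range n, (((algorithm hm πA πB πC).fold hj).cumDegree i : ℝ) =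
      (((algorithm hm πA πB πC).steps.filter fun st => st.label < n).map fun st =>
        ((Algorithm.foldStep hj st).degree : ℝ)).sum := by
  rw [← Nat.cast_sum]
  simp only [Algorithm.cumDegree]
  rw [Algorithm.sum_range_filter_label, Nat.cast_list_sum]
  simp only [Algorithm.fold, List.filter_map, List.map_map]
  rfl

/-- The inequality holds for each superstep separately; `1 / 5` is the ratio of the dummy messages
to the bound `5 * 2 ^ i` on all messages. -/
theorem algorithm_isWise : (algorithm hm πA πB πC).IsWise (1 / 5) (le_refl (2 * m)) := by
  refine ⟨by norm_num, by norm_num, by omega, fun j hj1 hj => ?_⟩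
  rw [sum_cumDegree_fold, sum_cumDegree_fold, ← List.sum_map_mul_left]
  refine List.sum_le_sum fun st hst => ?_
  obtain ⟨h1, h2⟩ := List.mem_filter.1 hst
  obtain ⟨i, hi⟩ := exists_isRegular hm πA πB πC h1
  have h2 : 3 * i < j := by
    have : st.label < j := by simpa using h2
    rwa [hi.label] at this
  have h3 : ((Algorithm.foldStep (le_refl (2 * m)) st).degree : ℝ) ≤ 5 * 2 ^ i := by
    have := hi.degree_le (le_refl (2 * m))
    rw [Nat.sub_self, pow_zero, mul_one] at this
    exact_mod_cast this
  have h4 : (2 : ℝ) ^ i * 2 ^ (2 * m - j) ≤ ((Algorithm.foldStep hj st).degree : ℝ) := by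
    exact_mod_cast hi.le_degree hj h2
  have e : (2 : ℝ) ^ (2 * m) / 2 ^ j = 2 ^ (2 * m - j) := by
    rw [div_eq_iff (by positivity), ← pow_add]
    congr 1
    omega
  rw [e]
  have h5 := mul_le_mul_of_nonneg_left h3 (show (0 : ℝ) ≤ 1 / 5 * 2 ^ (2 * m - j) by positivity)
  refine h5.trans (le_trans (le_of_eq ?_) h4)
  ring

/-! ### Communication complexity -/

theorem sum_map_filter_le {α : Type} (l : List α) (p : α → Prop) [DecidablePred p] (f g : α → ℝ)
    (hg : ∀ a ∈ l, 0 ≤ g a) (h : ∀ a ∈ l, p a → f a ≤ g a) :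
    ((l.filter fun a => p a).map f).sum ≤ (l.map g).sum := by
  induction l with
  | nil => simp
  | cons a l ih =>
    have ih := ih (fun b hb => hg b (List.mem_cons_of_mem _ hb))
      fun b hb => h b (List.mem_cons_of_mem _ hb)
    rw [List.filter_cons, List.map_cons, List.sum_cons]
    split_ifs with hp
    · rw [List.map_cons, List.sum_cons]
      exact add_le_add (h a List.mem_cons_self (by simpa using hp)) ih
    · linarith [hg a List.mem_cons_self]

theorem commComplexity_le_sum {k : ℕ} (hk : k ≤ 2 * m) {σ : ℝ} (hσ : 0 ≤ σ) :
    ((algorithm hm πA πB πC).fold hk).commComplexity σ ≤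
      3 * ∑ i ∈ Finset.range ((k + 2) / 3), (5 * 2 ^ i * 2 ^ (2 * m - k) + σ) := by
  classical
  -- The bound depends on the level alone and vanishes for levels that folding makes local. Every
  -- level occurs in two steps, and level 0 once more at the end, whence the factor 3; `(k + 2) / 3`
  -- levels have `3 * i < k`.
  set G : ℕ → ℝ := fun i => if 3 * i < k then 5 * 2 ^ i * 2 ^ (2 * m - k) + σ else 0 with hG
  have hG0 : ∀ i, 0 ≤ G i := by
    intro i
    simp only [hG]
    split_ifs <;> positivity
  have hGs : ∀ n, ∑ i ∈ Finset.range n, G i ≤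
      ∑ i ∈ Finset.range ((k + 2) / 3), (5 * 2 ^ i * 2 ^ (2 * m - k) + σ) := by
    intro n
    simp only [hG]
    rw [← Finset.sum_filter]
    refine Finset.sum_le_sum_of_subset_of_nonneg ?_ fun i _ _ => by positivity
    intro i hi
    have := (Finset.mem_filter.1 hi).2
    exact Finset.mem_range.2 (by omega)
  have hstep : ∀ {st : Step (2 * m) (Reg m)} {i : ℕ}, IsRegular st i → st.label < k →
      ((Algorithm.foldStep hk st).degree : ℝ) + σ ≤ G (st.label / 3) := by
    intro st i hi hlab
    have h1 : ((Algorithm.foldStep hk st).degree : ℝ) ≤ 5 * 2 ^ i * 2 ^ (2 * m - k) := by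
      exact_mod_cast hi.degree_le hk
    rw [hi.label] at hlab ⊢
    rw [Nat.mul_div_cancel_left _ (by norm_num)]
    simp only [hG]
    rw [if_pos hlab]
    linarith
  have h1 : ((algorithm hm πA πB πC).fold hk).commComplexity σ ≤
      (List.map (fun st : Step (2 * m) (Reg m) => G (st.label / 3))
        (algorithm hm πA πB πC).steps).sum := by
    rw [Algorithm.commComplexity_eq]
    simp only [Algorithm.fold, List.filter_map, List.map_map]
    refine sum_map_filter_le (α := Step (2 * m) (Reg m)) _ (fun st => st.label < k) _ _
      (fun _ _ => hG0 _) fun st hst hlab => ?_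
    obtain ⟨i, hi⟩ := exists_isRegular hm πA πB πC hst
    exact hstep hi hlab
  have h2 : (List.map (fun st : Step (2 * m) (Reg m) => G (st.label / 3))
        (algorithm hm πA πB πC).steps).sum =
      ∑ i ∈ Finset.range (levels m), G i + ∑ i ∈ Finset.range (levels m), G i +
        ∑ i ∈ Finset.range 1, G i := by
    have e : ∀ i, 3 * i / 3 = i := fun i => Nat.mul_div_cancel_left _ (by norm_num)
    simp only [algorithm, List.map_append, List.sum_append, List.map_map, Function.comp_def,
      List.map_reverse, List.sum_reverse, List.map_cons, List.map_nil, List.sum_cons, List.sum_nil,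
      distStep, collStep, lastStep, e, ← Fin.sum_univ_def, Finset.sum_range, Nat.zero_div]
    simp
  rw [h2] at h1
  linarith [hGs (levels m), hGs 1]

theorem lg_two_pow {k : ℕ} (hk : 1 ≤ k) : lg ((2 : ℝ) ^ k) = k := by
  rw [lg, ← Real.rpow_natCast, Real.logb_rpow (by norm_num) (by norm_num)]
  exact max_eq_right (by exact_mod_cast hk)

/-- The exponents add up to at most `(k + 2) / 3 + 2 * k / 3 = k + 2 / 3`; the factor 2 absorbs the
rounding. -/
theorem two_pow_mul_rpow_le (k : ℕ) :
    (2 : ℝ) ^ ((k + 2) / 3) * ((2 : ℝ) ^ k) ^ (2 / 3 : ℝ) ≤ 2 * 2 ^ k := by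
  have h1 : ((2 : ℝ) ^ k) ^ (2 / 3 : ℝ) = (2 : ℝ) ^ ((k : ℝ) * (2 / 3)) := by
    rw [← Real.rpow_natCast, ← Real.rpow_mul (by norm_num)]
  have h2 : (((k + 2) / 3 : ℕ) : ℝ) ≤ (k + 2) / 3 := by
    rw [le_div_iff₀ (by norm_num)]
    exact_mod_cast Nat.div_mul_le_self (k + 2) 3
  rw [h1, ← Real.rpow_natCast 2 ((k + 2) / 3), ← Real.rpow_add (by norm_num), ← pow_succ',
    ← Real.rpow_natCast 2 (k + 1)]
  refine Real.rpow_le_rpow_of_exponent_le (by norm_num) ?_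
  push_cast
  linarith

theorem commComplexity_le {k : ℕ} (hk1 : 1 ≤ k) (hk : k ≤ 2 * m) {σ : ℝ} (hσ : 0 ≤ σ) :
    ((algorithm hm πA πB πC).fold hk).commComplexity σ ≤
      30 * ((2 : ℝ) ^ (2 * m) / ((2 : ℝ) ^ k) ^ (2 / 3 : ℝ) + σ * lg ((2 : ℝ) ^ k)) := by
  refine (commComplexity_le_sum hm πA πB πC hk hσ).trans ?_
  -- The constant 30 is `3 * 5 * 2`: the number of passes over the levels, the messages per `2 ^ i`,
  -- and the rounding of `k / 3`.
  have h1 : ∑ i ∈ Finset.range ((k + 2) / 3), (5 * (2 : ℝ) ^ i * 2 ^ (2 * m - k) + σ) ≤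
      5 * 2 ^ ((k + 2) / 3) * 2 ^ (2 * m - k) + ((k + 2) / 3 : ℕ) * σ := by
    rw [Finset.sum_add_distrib, Finset.sum_const, Finset.card_range, nsmul_eq_mul,
      ← Finset.sum_mul, ← Finset.mul_sum, geom_sum_eq (by norm_num)]
    have : (0 : ℝ) < 2 ^ (2 * m - k) := by positivity
    norm_num
  have h2 : (((k + 2) / 3 : ℕ) : ℝ) ≤ k := by exact_mod_cast (by omega : (k + 2) / 3 ≤ k)
  have e : (2 : ℝ) ^ (2 * m) = 2 ^ (2 * m - k) * 2 ^ k := by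
    rw [← pow_add]
    congr 1
    omega
  have hq : (0 : ℝ) < ((2 : ℝ) ^ k) ^ (2 / 3 : ℝ) := by positivity
  have h3 : (2 : ℝ) ^ ((k + 2) / 3) * 2 ^ (2 * m - k) ≤
      2 * ((2 : ℝ) ^ (2 * m) / ((2 : ℝ) ^ k) ^ (2 / 3 : ℝ)) := by
    rw [← mul_div_assoc, le_div_iff₀ hq, e]
    have := mul_le_mul_of_nonneg_left (two_pow_mul_rpow_le k)
      (show (0 : ℝ) ≤ 2 ^ (2 * m - k) by positivity)
    linarith
  rw [lg_two_pow hk1]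
  have h4 := mul_le_mul_of_nonneg_right h2 hσ
  have h5 : 0 ≤ σ * k := by positivity
  linarith

end MM

/-! ### The four claims assembled -/

theorem mainTheorem3 :
    -- the algorithm belongs to the class (in particular, it multiplies matrices)
    (∀ (m : ℕ) (hm : 1 ≤ m) (πA πB πC : MM.Layout m),
      (MM.algorithm hm πA πB πC).InClass) ∧
    -- communication complexity `O(n / p ^ (2/3) + σ log p)` on `M(p, σ)`
    (∃ c : ℝ, 0 < c ∧
      ∀ (m : ℕ) (hm : 1 ≤ m) (πA πB πC : MM.Layout m) (k : ℕ) (_ : 1 ≤ k) (hk : k ≤ 2 * m)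
        (σ : ℝ), 0 ≤ σ →
        ((MM.algorithm hm πA πB πC).fold hk).commComplexity σ ≤
          c * ((2 : ℝ) ^ (2 * m) / ((2 : ℝ) ^ k) ^ (2 / 3 : ℝ) + σ * lg ((2 : ℝ) ^ k))) ∧
    -- `(Θ(1), n)`-wiseness
    (∃ α : ℝ, ∀ (m : ℕ) (hm : 1 ≤ m) (πA πB πC : MM.Layout m),
      (MM.algorithm hm πA πB πC).IsWise α (le_refl (2 * m))) ∧
    -- `Θ(1)`-optimality on `M(p, σ)` for `σ = O(n / (p ^ (2/3) log p))`
    (∀ K : ℝ, 0 < K → ∃ β : ℝ, 0 < β ∧ β ≤ 1 ∧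
      ∀ (m : ℕ) (hm : 1 ≤ m) (πA πB πC : MM.Layout m) (k : ℕ) (_ : 1 ≤ k) (hk : k ≤ 2 * m)
        (σ : ℝ), 0 ≤ σ →
        σ ≤ K * ((2 : ℝ) ^ (2 * m) / (((2 : ℝ) ^ k) ^ (2 / 3 : ℝ) * lg ((2 : ℝ) ^ k))) →
        ((MM.algorithm hm πA πB πC).fold hk).IsOptimal β σ) := by
  refine ⟨fun m hm πA πB πC => MM.algorithm_inClass hm πA πB πC, ⟨30, by norm_num,
    fun m hm πA πB πC k hk1 hk σ hσ => MM.commComplexity_le hm πA πB πC hk1 hk hσ⟩,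
    ⟨1 / 5, fun m hm πA πB πC => MM.algorithm_isWise hm πA πB πC⟩, fun K hK => ?_⟩
  -- The upper bound is at most `30 * (1 + K)` and the lower bound at least `1 / 50` times `n / p ^
  -- (2/3)`; `1500 = 30 * 50`.
  have hK' : 0 < 1500 * (1 + K) := by positivity
  refine ⟨1 / (1500 * (1 + K)), by positivity, by rw [div_le_one hK']; linarith,
    fun m hm πA πB πC k hk1 hk σ hσ hσK => ⟨MM.fold_inClass hm πA πB πC hk, fun ℬ hℬ => ?_⟩⟩
  have h1 := MM.commComplexity_le hm πA πB πC hk1 hk hσ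
  have h2 := hℬ.commComplexity_ge (by positivity) hk1 hσ
  have e : (((2 ^ m : ℕ) : ℝ)) ^ 2 = 2 ^ (2 * m) := by
    push_cast
    rw [← pow_mul, mul_comm]
  rw [e] at h2
  have hlg : 0 < lg ((2 : ℝ) ^ k) := lt_of_lt_of_le one_pos (le_max_left _ _)
  have h3 : σ * lg ((2 : ℝ) ^ k) ≤
      K * ((2 : ℝ) ^ (2 * m) / ((2 : ℝ) ^ k) ^ (2 / 3 : ℝ)) := by
    refine (mul_le_mul_of_nonneg_right hσK hlg.le).trans (le_of_eq ?_)
    field_simp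
  rw [one_div_one_div]
  calc _ ≤ 30 * ((1 + K) * ((2 : ℝ) ^ (2 * m) / ((2 : ℝ) ^ k) ^ (2 / 3 : ℝ))) := by linarith
    _ = 1500 * (1 + K) * (1 / 50 * ((2 : ℝ) ^ (2 * m) / ((2 : ℝ) ^ k) ^ (2 / 3 : ℝ))) := by ring
    _ ≤ _ := mul_le_mul_of_nonneg_left h2 hK'.le
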